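/- Let $X$ be a nonempty CAT(0) space, and let a group $G$ act geometrically on $X$, that is, properly discontinuously, cocompactly and by isometries. For $k \ge 2$, a $k$-flat in $X$ is the image of an isometric embedding of Euclidean space $\mathbb{E}^k$ into $X$, and a flat is a $k$-flat for some $k \ge 2$. Suppose that $X$ has isolated flats, that is, there is a family $\mathcal{F}$ of flats in $X$ such that 1. (Maximal) there is a constant $B$ such that every flat in $X$ is contained in the $B$-neighborhood of some flat $F' \in \mathcal{F}$; 2. (Isolated) there is a function $\psi \colon \mathbb{R}_{\ge 0} \to \mathbb{R}_{\ge 0}$ such that for every pair of distinct flats $F_1, F_2 \in \mathcal{F}$ and every $r \ge 0$, the intersection of the $r$-neighborhoods of $F_1$ and $F_2$ has diameter at most $\psi(r)$; 3. (Equivariant) $\mathcal{F}$ is invariant under the action of the full isometry group $\mathrm{Isom}(X)$. Then for every integer $k \ge 2$, the space $X$ contains a $k$-flat if and only if $G$ contains a subgroup isomorphic to $\mathbb{Z}^k$. -/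

import Mathlib

/-- `γ`, restricted to the interval `[0, dist p q]`, is a geodesic from `p` to `q`, i.e. an isometric
embedding of that interval which starts at `p` and ends at `q`.
(The values of `γ` outside the interval are irrelevant.) -/
def IsGeodesicFromTo {X : Type*} [MetricSpace X] (γ : ℝ → X) (p q : X) : Prop :=
  γ 0 = p ∧ γ (dist p q) = q ∧
    ∀ s ∈ Set.Icc (0 : ℝ) (dist p q), ∀ t ∈ Set.Icc (0 : ℝ) (dist p q),
      dist (γ s) (γ t) = |s - t|

/-- A `CAT(0)` space: a geodesic metric space in which distances between points of a geodesic
triangle are at most the distances between the corresponding points of a comparison triangle. -/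
structure IsCAT0 (X : Type*) [MetricSpace X] : Prop where
  /-- Every two points are joined by a geodesic. -/
  geodesic : ∀ p q : X, ∃ γ : ℝ → X, IsGeodesicFromTo γ p q
  /-- The geodesic triangle has vertices `v 0, v 1, v 2`, and its side `γ i` joins `v i` to
  `v (i + 1)` (indices modulo `3`); `w` is a comparison triangle in the Euclidean plane. The points
  `γ i s` and `γ j t` of the triangle correspond to the points `x` and `y` on the `i`-th and `j`-th
  side of the comparison triangle, at distance `s` from `w i` and `t` from `w j`, respectively. -/
  comparison : ∀ (v : Fin 3 → X) (γ : Fin 3 → ℝ → X),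
    (∀ i, IsGeodesicFromTo (γ i) (v i) (v (i + 1))) →
    ∀ w : Fin 3 → EuclideanSpace ℝ (Fin 2),
    (∀ i j, dist (w i) (w j) = dist (v i) (v j)) →
    ∀ (i j : Fin 3),
    ∀ s ∈ Set.Icc (0 : ℝ) (dist (v i) (v (i + 1))),
    ∀ t ∈ Set.Icc (0 : ℝ) (dist (v j) (v (j + 1))),
    ∀ x ∈ segment ℝ (w i) (w (i + 1)), ∀ y ∈ segment ℝ (w j) (w (j + 1)),
      dist (w i) x = s → dist (w j) y = t →
      dist (γ i s) (γ j t) ≤ dist x y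

/-- The action of `G` on `X` is geometric: isometric, properly discontinuous and cocompact. -/
structure IsGeometricAction (G X : Type*) [Group G] [MetricSpace X] [MulAction G X] : Prop where
  isometric : IsIsometricSMul G X
  properlyDiscontinuous : ProperlyDiscontinuousSMul G X
  cocompact : ∃ K : Set X, IsCompact K ∧ ⋃ g : G, (fun x : X => g • x) '' K = Set.univ

/-- A `k`-flat, `k ≥ 2`, as a subset: the image of an isometric embedding of Euclidean `k`-space. -/
def IsKFlat {X : Type*} [MetricSpace X] (k : ℕ) (F : Set X) : Prop :=
  2 ≤ k ∧ ∃ f : EuclideanSpace ℝ (Fin k) → X, Isometry f ∧ Set.range f = F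

/-- A flat is a `k`-flat for some `k ≥ 2`. -/
def IsFlat {X : Type*} [MetricSpace X] (F : Set X) : Prop :=
  ∃ k : ℕ, IsKFlat k F

/-- `X` has isolated flats, with respect to some family `𝓕` of flats. The `r`-neighbourhood of a
set is `Metric.thickening r`; the bound on the diameter is written out for pairs of points. -/
def HasIsolatedFlats (X : Type*) [MetricSpace X] : Prop :=
  ∃ 𝓕 : Set (Set X),
    (∀ F ∈ 𝓕, IsFlat F) ∧
    (∃ B : ℝ, ∀ F : Set X, IsFlat F → ∃ F' ∈ 𝓕, F ⊆ Metric.thickening B F') ∧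
    (∃ ψ : NNReal → NNReal, ∀ F₁ ∈ 𝓕, ∀ F₂ ∈ 𝓕, F₁ ≠ F₂ → ∀ r : NNReal,
      ∀ x ∈ Metric.thickening (r : ℝ) F₁ ∩ Metric.thickening (r : ℝ) F₂,
      ∀ y ∈ Metric.thickening (r : ℝ) F₁ ∩ Metric.thickening (r : ℝ) F₂,
        dist x y ≤ (ψ r : ℝ)) ∧
    (∀ φ : X ≃ᵢ X, ∀ F ∈ 𝓕, φ '' F ∈ 𝓕)

/-! The two directions are independent; only the passage from flats to subgroups uses isolation.

From `ℤ^k` to a flat (the Flat Torus Theorem). The space is proper, and displacement functions are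
convex, so a finitely generated abelian subgroup has a point `x` at which every element attains its
asymptotic displacement (`IsGeometricAction.exists_forall_dist_smul_eq`). The function `N a = dist x
(a x)` then doubles under `a ↦ 2a`. The CAT(0) inequality at midpoints gives one half of the
parallelogram law, and substituting `a + b`, `a - b` gives the other. Hence `N` is a Euclidean norm
restricted to `ℤ^k`, and the orbit of `x` is an isometric copy of a lattice. Points at fraction
`1/t` of geodesics to ever larger lattice points converge to an isometric copy of the whole
Euclidean space (`IsCAT0.exists_isometry_of_lattice`).

From a flat to `ℤ^k`. The flat lies near some `F'` in the isolated family, whose dimension is at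
least `k` because coarse isometries do not lower dimension. Isolation makes the family locally
finite, so cocompactness on `X` yields coarsely dense orbits of the stabiliser of `F'` on `F'`. This
stabiliser acts properly by Euclidean isometries, and Bieberbach's theorem
(`span_translations_eq_top`) supplies translations spanning `F'`. The kernel of the action is
finite, so suitable powers of lifts of these translations commute and generate a free abelian group.
-/

/-! ### Comparison triangles and CAT(0) inequalities. -/

/-- Every triple of lengths satisfying the triangle inequalities is realised in the plane. -/
theorem exists_comparison_triangle {X : Type*} [MetricSpace X] (v : Fin 3 → X) :
    ∃ w : Fin 3 → EuclideanSpace ℝ (Fin 2), ∀ i j, dist (w i) (w j) = dist (v i) (v j) := by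
  suffices h : ∃ w : Fin 3 → EuclideanSpace ℝ (Fin 2), dist (w 0) (w 1) = dist (v 0) (v 1) ∧
      dist (w 0) (w 2) = dist (v 0) (v 2) ∧ dist (w 1) (w 2) = dist (v 1) (v 2) by
    obtain ⟨w, h01, h02, h12⟩ := h
    have h10 := h01
    have h20 := h02
    have h21 := h12
    rw [dist_comm, dist_comm (v 0)] at h10 h20
    rw [dist_comm, dist_comm (v 1)] at h21
    refine ⟨w, fun i j => ?_⟩
    fin_cases i <;> fin_cases j <;> first | assumption | simp
  set a := dist (v 0) (v 1) with ha
  set c := dist (v 0) (v 2) with hc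
  set b := dist (v 1) (v 2) with hb
  have t1 : a ≤ c + b := by
    simpa [ha, hb, hc, dist_comm (v 1) (v 2)] using dist_triangle (v 0) (v 2) (v 1)
  have t2 : c ≤ a + b := dist_triangle _ _ _
  have t3 : b ≤ a + c := by
    simpa [ha, hb, hc, dist_comm (v 1) (v 0)] using dist_triangle (v 1) (v 0) (v 2)
  have hc0 : 0 ≤ c := dist_nonneg
  have hb0 : 0 ≤ b := dist_nonneg
  have ha0 : 0 ≤ a := dist_nonneg
  clear_value a b c
  rcases ha0.eq_or_lt with h0 | h0
  · refine ⟨![!₂[0, 0], !₂[0, 0], !₂[c, 0]], ?_, ?_, ?_⟩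
    · simp [← h0]
    · simp [EuclideanSpace.dist_eq, Fin.sum_univ_two, Real.dist_eq, hc0]
    · simp [EuclideanSpace.dist_eq, Fin.sum_univ_two, Real.dist_eq, hc0]
      linarith
  · have hane : a ≠ 0 := h0.ne'
    -- By the law of cosines, `u` is the first coordinate of the third vertex; it needs `a ≠ 0`.
    set u := (a ^ 2 + c ^ 2 - b ^ 2) / (2 * a) with hu
    have hua : 2 * a * u = a ^ 2 + c ^ 2 - b ^ 2 := by
      rw [hu, mul_div_cancel₀ _ (mul_ne_zero two_ne_zero hane)]
    have h1 : 0 ≤ c - u := by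
      rw [hu, sub_nonneg, div_le_iff₀ (by positivity)]
      nlinarith
    have h2 : 0 ≤ c + u := by
      have : -c ≤ u := by
        rw [hu, le_div_iff₀ (by positivity)]
        nlinarith
      linarith
    have h3 : 0 ≤ c ^ 2 - u ^ 2 := by nlinarith
    refine ⟨![!₂[0, 0], !₂[a, 0], !₂[u, √(c ^ 2 - u ^ 2)]], ?_, ?_, ?_⟩
    · simp [EuclideanSpace.dist_eq, Fin.sum_univ_two, Real.dist_eq, Real.sqrt_sq ha0]
    · simp [EuclideanSpace.dist_eq, Fin.sum_univ_two, Real.dist_eq, Real.sq_sqrt h3, hc0]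
    · simp [EuclideanSpace.dist_eq, Fin.sum_univ_two, Real.dist_eq, Real.sq_sqrt h3]
      rw [show (a - u) ^ 2 + (c ^ 2 - u ^ 2) = b ^ 2 by linarith [hua], Real.sqrt_sq hb0]

theorem dist_sq_lineMap {E : Type*} [NormedAddCommGroup E] [InnerProductSpace ℝ E]
    (x y p : E) (l : ℝ) :
    dist (AffineMap.lineMap x y l) p ^ 2 =
      (1 - l) * dist x p ^ 2 + l * dist y p ^ 2 - l * (1 - l) * dist x y ^ 2 := by
  simp only [dist_eq_norm]
  have e1 : AffineMap.lineMap x y l - p = (1 - l) • (x - p) + l • (y - p) := by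
    rw [AffineMap.lineMap_apply_module]; module
  have e2 : x - y = (x - p) - (y - p) := by abel
  rw [e1, e2]
  generalize x - p = a
  generalize y - p = b
  rw [norm_add_sq_real, norm_sub_sq_real, norm_smul, norm_smul, inner_smul_left,
    inner_smul_right, mul_pow, mul_pow, Real.norm_eq_abs, Real.norm_eq_abs, sq_abs, sq_abs]
  simp
  ring

namespace IsCAT0

variable {X : Type*} [MetricSpace X]

/-- Along a geodesic, the squared distance to a point obeys Stewart's inequality. -/
theorem exists_stewart (hX : IsCAT0 X) (x y : X) {l : ℝ} (hl : l ∈ Set.Icc (0 : ℝ) 1) :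
    ∃ m : X, dist x m = l * dist x y ∧ dist m y = (1 - l) * dist x y ∧
      ∀ p, dist m p ^ 2 ≤
        (1 - l) * dist x p ^ 2 + l * dist y p ^ 2 - l * (1 - l) * dist x y ^ 2 := by
  obtain ⟨γ, h0, h1, hγ⟩ := hX.geodesic x y
  have hd : (0 : ℝ) ≤ dist x y := dist_nonneg
  have hs : l * dist x y ∈ Set.Icc (0 : ℝ) (dist x y) :=
    ⟨mul_nonneg hl.1 hd, mul_le_of_le_one_left hd hl.2⟩
  refine ⟨γ (l * dist x y), ?_, ?_, fun p => ?_⟩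
  · have := hγ 0 ⟨le_rfl, hd⟩ _ hs
    rw [h0] at this
    rw [this, zero_sub, abs_neg, abs_of_nonneg hs.1]
  · have := hγ _ hs (dist x y) ⟨hd, le_rfl⟩
    rw [h1] at this
    rw [this, abs_sub_comm, abs_of_nonneg (by linarith [hs.2])]
    ring
  · obtain ⟨γ₁, hγ₁⟩ := hX.geodesic y p
    obtain ⟨γ₂, hγ₂⟩ := hX.geodesic p x
    obtain ⟨w, hw⟩ := exists_comparison_triangle ![x, y, p]
    have hg : ∀ i : Fin 3, IsGeodesicFromTo ((![γ, γ₁, γ₂] : Fin 3 → ℝ → X) i)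
        ((![x, y, p] : Fin 3 → X) i) ((![x, y, p] : Fin 3 → X) (i + 1)) := by
      intro i
      fin_cases i
      · exact ⟨h0, h1, hγ⟩
      · exact hγ₁
      · exact hγ₂
    have h01 : dist (w 0) (w 1) = dist x y := hw 0 1
    have h02 : dist (w 0) (w 2) = dist x p := hw 0 2
    have h12 : dist (w 1) (w 2) = dist y p := hw 1 2
    -- Side `2` starts at `p`, so parameter `0` on it compares an interior point of side `0` with
    -- the opposite vertex.
    have := hX.comparison ![x, y, p] ![γ, γ₁, γ₂] hg w hw 0 2 (l * dist x y) hs 0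
      ⟨le_rfl, dist_nonneg⟩ (AffineMap.lineMap (w 0) (w 1) l)
      (by rw [segment_eq_image_lineMap]; exact ⟨l, hl, rfl⟩) (w 2)
      (left_mem_segment _ _ _)
      (by rw [dist_left_lineMap, h01, Real.norm_eq_abs, abs_of_nonneg hl.1]) (dist_self _)
    have e : (![γ, γ₁, γ₂] : Fin 3 → ℝ → X) 2 0 = p := hγ₂.1
    rw [e] at this
    calc dist (γ (l * dist x y)) p ^ 2 ≤ dist (AffineMap.lineMap (w 0) (w 1) l) (w 2) ^ 2 := by
          gcongr; exact this
      _ = _ := by rw [dist_sq_lineMap, h01, h02, h12]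

/-- Stewart's inequality, for every point that divides `x y` in the ratio `l : 1 - l`. -/
theorem stewart (hX : IsCAT0 X) {x y m : X} {l : ℝ} (hl : l ∈ Set.Icc (0 : ℝ) 1)
    (h1 : dist x m = l * dist x y) (h2 : dist m y = (1 - l) * dist x y) (p : X) :
    dist m p ^ 2 ≤ (1 - l) * dist x p ^ 2 + l * dist y p ^ 2 - l * (1 - l) * dist x y ^ 2 := by
  -- Stewart's inequality for `n`, tested at `m`, has right-hand side zero, so the dividing point is
  -- unique.
  obtain ⟨n, -, -, hn⟩ := hX.exists_stewart x y hl
  have := hn m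
  rw [h1, dist_comm y m, h2] at this
  have h0 : dist n m ^ 2 ≤ 0 := this.trans (le_of_eq (by ring))
  have : n = m := dist_eq_zero.1 (pow_eq_zero_iff two_ne_zero |>.1
    (le_antisymm h0 (sq_nonneg _)))
  exact this ▸ hn p

/-- Points on two geodesics issuing from `p`: comparison in terms of the three side lengths. -/
theorem dist_sq_le (hX : IsCAT0 X) {p x y m n : X} {l r : ℝ} (hl : l ∈ Set.Icc (0 : ℝ) 1)
    (hr : r ∈ Set.Icc (0 : ℝ) 1)
    (hm : dist p m = l * dist p x) (hm' : dist m x = (1 - l) * dist p x)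
    (hn : dist p n = r * dist p y) (hn' : dist n y = (1 - r) * dist p y) :
    dist m n ^ 2 ≤ l ^ 2 * dist p x ^ 2 + r ^ 2 * dist p y ^ 2
      - l * r * (dist p x ^ 2 + dist p y ^ 2 - dist x y ^ 2) := by
  have h1 := hX.stewart hl hm hm' n
  have h2 := hX.stewart hr hn hn' x
  rw [dist_comm n x, dist_comm y x] at h2
  rw [hn] at h1
  nlinarith [mul_le_mul_of_nonneg_left h2 hl.1]

theorem exists_midpoint (hX : IsCAT0 X) (x y : X) :
    ∃ m : X, dist x m = 1 / 2 * dist x y ∧ dist m y = 1 / 2 * dist x y := by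
  obtain ⟨m, h1, h2, -⟩ := hX.exists_stewart x y (l := 1 / 2) (by norm_num)
  exact ⟨m, h1, by rw [h2]; ring⟩

theorem dist_midpoint_le_of_common (hX : IsCAT0 X) {p x y m n : X}
    (hm : dist p m = 1 / 2 * dist p x) (hm' : dist m x = 1 / 2 * dist p x)
    (hn : dist p n = 1 / 2 * dist p y) (hn' : dist n y = 1 / 2 * dist p y) :
    dist m n ≤ 1 / 2 * dist x y := by
  have := hX.dist_sq_le (l := 1 / 2) (r := 1 / 2) (by norm_num) (by norm_num) hm
    (by rw [hm']; ring) hn (by rw [hn']; ring)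
  refine abs_le_of_sq_le_sq' ?_ (by positivity) |>.2
  nlinarith

/-- The distance of midpoints is at most the mean of the distances of the endpoints. -/
theorem dist_midpoint_le (hX : IsCAT0 X) {x y m x' y' m' : X}
    (hm : dist x m = 1 / 2 * dist x y) (hm' : dist m y = 1 / 2 * dist x y)
    (hn : dist x' m' = 1 / 2 * dist x' y') (hn' : dist m' y' = 1 / 2 * dist x' y') :
    dist m m' ≤ 1 / 2 * (dist x x' + dist y y') := by
  -- The midpoint of a diagonal splits the quadrilateral into two triangles.
  obtain ⟨c, hc, hc'⟩ := hX.exists_midpoint x y'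
  have h1 := hX.dist_midpoint_le_of_common hm hm' hc hc'
  have h2 := hX.dist_midpoint_le_of_common (p := y') (x := x) (y := x') (m := c) (n := m')
    (by rw [dist_comm, hc', dist_comm x]) (by rw [dist_comm, hc, dist_comm x])
    (by rw [dist_comm, hn', dist_comm x']) (by rw [dist_comm, hn, dist_comm x'])
  linarith [dist_triangle m c m']

end IsCAT0

/-! ### Properness from a geometric action. -/

section ProperAction

variable {G X : Type*} [Group G] [MetricSpace X] [MulAction G X] [IsIsometricSMul G X]
  [ProperlyDiscontinuousSMul G X]

/-- For a properly discontinuous action on a metric space, only finitely many translates of a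
compact set come close to a given point. -/
theorem exists_finite_smul_inter_closedBall {K : Set X} (hK : IsCompact K) (x : X) :
    ∃ ε > 0, {g : G | ∃ y ∈ K, dist (g • y) x ≤ ε}.Finite := by
  by_contra! hcon
  obtain ⟨f, hP, hr⟩ := exists_seq_of_forall_finset_exists
    (fun p : G × ℕ => ∃ y ∈ K, dist (p.1 • y) x ≤ 1 / ((p.2 : ℝ) + 1))
    (fun p q => p.1 ≠ q.1 ∧ p.2 < q.2) (by
      classical
      intro s _
      set N := s.sup Prod.snd + 1 with hN
      obtain ⟨g, hg, hgs⟩ := (hcon (1 / ((N : ℝ) + 1)) (by positivity)).exists_notMem_finset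
        (s.image Prod.fst)
      refine ⟨(g, N), hg, fun p hp => ⟨?_, ?_⟩⟩
      · rintro rfl
        exact hgs (Finset.mem_image_of_mem _ hp)
      · exact Nat.lt_succ_of_le (Finset.le_sup (f := Prod.snd) hp))
  choose y hyK hy using hP
  obtain ⟨z, -, φ, hφ, hz⟩ := hK.tendsto_subseq hyK
  have hinj : Function.Injective fun n => (f n).1 := by
    intro m n hmn
    by_contra hne
    rcases lt_or_gt_of_ne hne with h | h
    · exact (hr m n h).1 hmn
    · exact (hr n m h).1 hmn.symm
  have hmono : StrictMono fun n => (f n).2 := fun m n h => (hr m n h).2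
  -- Replacing `y (φ n)` by its limit `z` costs nothing asymptotically. The translates of `z` with
  -- their limit `x` form a compact set, so proper discontinuity applies although balls are not yet
  -- known to be compact.
  have hlim : Filter.Tendsto (fun n => (f (φ n)).1 • z) Filter.atTop (nhds x) := by
    rw [tendsto_iff_dist_tendsto_zero]
    have h1 : Filter.Tendsto (fun n => 1 / (((f (φ n)).2 : ℝ) + 1)) Filter.atTop (nhds 0) :=
      tendsto_one_div_add_atTop_nhds_zero_nat.comp (hmono.comp hφ).tendsto_atTop
    have h2 := (tendsto_iff_dist_tendsto_zero.1 hz).add h1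
    rw [add_zero] at h2
    refine squeeze_zero (fun _ => dist_nonneg) (fun n => ?_) h2
    refine (dist_triangle _ ((f (φ n)).1 • y (φ n)) _).trans (add_le_add ?_ (hy _))
    rw [dist_smul, dist_comm]
    rfl
  have hfin := ProperlyDiscontinuousSMul.finite_disjoint_inter_image (Γ := G)
    (isCompact_singleton (x := z)) hlim.isCompact_insert_range
  refine (Set.infinite_range_of_injective (hinj.comp hφ.injective)).mono ?_ hfin
  rintro _ ⟨n, rfl⟩
  exact ⟨_, ⟨z, rfl, rfl⟩, Or.inr ⟨n, rfl⟩⟩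

/-- A small ball is covered by the finitely many translates of `K` that come near its centre. -/
theorem locallyCompactSpace_of_cocompact {K : Set X} (hK : IsCompact K)
    (hcov : ⋃ g : G, (fun x : X => g • x) '' K = Set.univ) : LocallyCompactSpace X := by
  suffices WeaklyLocallyCompactSpace X from inferInstance
  refine ⟨fun x => ?_⟩
  obtain ⟨ε, hε, hfin⟩ := exists_finite_smul_inter_closedBall (G := G) hK x
  refine ⟨Metric.closedBall x ε, ?_, Metric.closedBall_mem_nhds x hε⟩
  refine (hfin.isCompact_biUnion (f := fun g : G => (fun x : X => g • x) '' K) fun g _ =>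
    hK.image (isometry_smul X g).continuous).of_isClosed_subset Metric.isClosed_closedBall ?_
  intro z hz
  have : z ∈ ⋃ g : G, (fun x : X => g • x) '' K := hcov ▸ Set.mem_univ z
  obtain ⟨g, y, hy, rfl⟩ := Set.mem_iUnion.1 this
  exact Set.mem_biUnion (show g ∈ _ from ⟨y, hy, hz⟩) ⟨y, hy, rfl⟩

/-- Local compactness gives one radius that works over all of `K`; translating by `G` makes it
uniform on `X`. -/
theorem exists_isCompact_closedBall_of_cocompact {K : Set X} (hK : IsCompact K)
    (hcov : ⋃ g : G, (fun x : X => g • x) '' K = Set.univ) :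
    ∃ δ > 0, ∀ x : X, IsCompact (Metric.closedBall x δ) := by
  have := locallyCompactSpace_of_cocompact hK hcov
  obtain ⟨δ, hδ, hc⟩ := hK.exists_isCompact_cthickening
  refine ⟨δ, hδ, fun x => ?_⟩
  have : x ∈ ⋃ g : G, (fun x : X => g • x) '' K := hcov ▸ Set.mem_univ x
  obtain ⟨g, y, hy, rfl⟩ := Set.mem_iUnion.1 this
  have h1 : IsCompact (Metric.closedBall y δ) :=
    hc.of_isClosed_subset Metric.isClosed_closedBall (Metric.closedBall_subset_cthickening hy δ)
  have h2 := h1.image (isometry_smul X g).continuous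
  rwa [Set.image_smul, Metric.smul_closedBall] at h2

end ProperAction

/-- A geodesic space whose closed balls of some fixed radius are compact is proper. -/
theorem properSpace_of_isCompact_closedBall {X : Type*} [MetricSpace X] (hX : IsCAT0 X)
    {δ : ℝ} (hδ : 0 < δ) (h : ∀ x : X, IsCompact (Metric.closedBall x δ)) : ProperSpace X := by
  have key : ∀ (n : ℕ) (x : X), IsCompact (Metric.closedBall x (n * (δ / 2))) := by
    intro n x
    induction n with
    | zero => simp
    | succ n ih =>
      -- Take a `δ/2`-net of the smaller ball. Moving back along a geodesic puts each point of the
      -- larger ball within `δ/2` of the smaller one, hence within `δ` of the net.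
      obtain ⟨t, htf, ht⟩ := Metric.totallyBounded_iff.1 ih.totallyBounded (δ / 2) (by positivity)
      refine (htf.isCompact_biUnion fun y _ => h y).of_isClosed_subset
        Metric.isClosed_closedBall ?_
      intro z hz
      rw [Metric.mem_closedBall, dist_comm] at hz
      push_cast at hz
      obtain ⟨w, hw1, hw2⟩ : ∃ w, dist x w ≤ n * (δ / 2) ∧ dist w z ≤ δ / 2 := by
        rcases le_or_gt (dist x z) (n * (δ / 2)) with hle | hgt
        · exact ⟨z, hle, by simp; positivity⟩
        · have hn : (0 : ℝ) ≤ n * (δ / 2) := by positivity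
          have hpos : 0 < dist x z := hn.trans_lt hgt
          obtain ⟨w, h1, h2, -⟩ := hX.exists_stewart x z (l := n * (δ / 2) / dist x z)
            ⟨by positivity, (div_le_one hpos).2 hgt.le⟩
          rw [div_mul_cancel₀ _ hpos.ne'] at h1
          rw [sub_mul, div_mul_cancel₀ _ hpos.ne'] at h2
          exact ⟨w, h1.le, by rw [h2]; linarith⟩
      obtain ⟨y, hy, hyw⟩ := Set.mem_iUnion₂.1 (ht (show w ∈ _ by
        rw [Metric.mem_closedBall, dist_comm]; exact hw1))
      refine Set.mem_biUnion hy ?_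
      rw [Metric.mem_ball] at hyw
      rw [Metric.mem_closedBall, dist_comm]
      linarith [dist_triangle y w z, dist_comm y w]
  refine ⟨fun x r => ?_⟩
  obtain ⟨n, hn⟩ := exists_nat_ge (r / (δ / 2))
  exact (key n x).of_isClosed_subset Metric.isClosed_closedBall
    (Metric.closedBall_subset_closedBall ((div_le_iff₀ (by positivity)).1 hn))

namespace IsGeometricAction

variable {G X : Type*} [Group G] [MetricSpace X] [MulAction G X]

theorem properSpace (hX : IsCAT0 X) (hG : IsGeometricAction G X) : ProperSpace X := by
  have := hG.isometric
  have := hG.properlyDiscontinuous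
  obtain ⟨K, hK, hcov⟩ := hG.cocompact
  obtain ⟨δ, hδ, h⟩ := exists_isCompact_closedBall_of_cocompact hK hcov
  exact properSpace_of_isCompact_closedBall hX hδ h

theorem finite_dist_smul_le [ProperSpace X] (hG : IsGeometricAction G X) (x : X) (R : ℝ) :
    {g : G | dist x (g • x) ≤ R}.Finite := by
  have := hG.properlyDiscontinuous
  refine (ProperlyDiscontinuousSMul.finite_disjoint_inter_image (Γ := G)
    (isCompact_singleton (x := x)) (isCompact_closedBall x R)).subset fun g hg => ?_
  exact ⟨g • x, ⟨x, rfl, rfl⟩, by rw [Metric.mem_closedBall, dist_comm]; exact hg⟩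

/-- Given isometries `a i` in finite number and points moved a bounded distance by them, some
conjugate of the family occurs infinitely often after translating the points to a compact set. -/
theorem exists_conj_subseq [ProperSpace X] (hG : IsGeometricAction G X) {ι : Type*} [Finite ι]
    (a : ι → G) (x : ℕ → X) {R : ℝ} (hR : ∀ i n, dist (x n) (a i • x n) ≤ R) :
    ∃ (φ : ℕ → ℕ) (g : ℕ → G) (y : X), StrictMono φ ∧
      (∀ i m n, g m * a i * (g m)⁻¹ = g n * a i * (g n)⁻¹) ∧
      Filter.Tendsto (fun n => g n • x (φ n)) Filter.atTop (nhds y) := by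
  have := hG.isometric
  obtain ⟨K, hK, hcov⟩ := hG.cocompact
  have hmem : ∀ n, ∃ g : G, g • x n ∈ K := by
    intro n
    have : x n ∈ ⋃ g : G, (fun x : X => g • x) '' K := hcov ▸ Set.mem_univ _
    obtain ⟨g, y, hy, hyx⟩ := Set.mem_iUnion.1 this
    exact ⟨g⁻¹, by rw [← hyx]; simpa using hy⟩
  choose g hg using hmem
  obtain ⟨z, -, φ, hφ, hz⟩ := hK.tendsto_subseq hg
  obtain ⟨N, hN⟩ := Filter.eventually_atTop.1 (Metric.tendsto_nhds.1 hz 1 one_pos)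
  set S : Set G := {h : G | dist z (h • z) ≤ R + 2} with hS
  have hSf : S.Finite := hG.finite_dist_smul_le z _
  have hc : ∀ n ≥ N, ∀ i, g (φ n) * a i * (g (φ n))⁻¹ ∈ S := by
    intro n hn i
    have h1 : dist (g (φ n) • x (φ n)) z < 1 := hN n hn
    set h := g (φ n) * a i * (g (φ n))⁻¹ with hh
    have h2 : dist (g (φ n) • x (φ n)) (h • g (φ n) • x (φ n)) ≤ R := by
      rw [hh, smul_smul, inv_mul_cancel_right, mul_smul, dist_smul]
      exact hR i _
    have h3 : dist (h • g (φ n) • x (φ n)) (h • z) < 1 := by rwa [dist_smul]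
    have := dist_triangle4 z (g (φ n) • x (φ n)) (h • g (φ n) • x (φ n)) (h • z)
    rw [dist_comm z (g (φ n) • x (φ n))] at this
    show dist z (h • z) ≤ R + 2
    linarith
  have := hSf.to_subtype
  -- Pigeonhole: there are only finitely many possible tuples of conjugates in `S`.
  obtain ⟨c, hcinf⟩ := Finite.exists_infinite_fiber
    (fun n : ℕ => fun i => (⟨g (φ (N + n)) * a i * (g (φ (N + n)))⁻¹,
      hc (N + n) (by omega) i⟩ : S))
  rw [Set.infinite_coe_iff] at hcinf
  have hfreq : ∃ᶠ n in Filter.atTop, n ∈ (fun n : ℕ => fun i =>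
      (⟨g (φ (N + n)) * a i * (g (φ (N + n)))⁻¹, hc (N + n) (by omega) i⟩ : S)) ⁻¹' {c} :=
    Nat.frequently_atTop_iff_infinite.2 hcinf
  obtain ⟨ψ, hψ, hψc⟩ := Filter.extraction_of_frequently_atTop hfreq
  have hmono : StrictMono fun n => N + ψ n := fun m n h => Nat.add_lt_add_left (hψ h) N
  refine ⟨fun n => φ (N + ψ n), fun n => g (φ (N + ψ n)), z, hφ.comp hmono, ?_,
    hz.comp hmono.tendsto_atTop⟩
  intro i m n
  have h1 := congrArg Subtype.val (congrFun (hψc m) i)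
  have h2 := congrArg Subtype.val (congrFun (hψc n) i)
  exact h1.trans h2.symm

end IsGeometricAction

/-! ### Asymptotic displacement and common minimal points. -/

section TranslationLength

open Filter Topology

variable {G X : Type*} [Group G] [MetricSpace X] [MulAction G X]

/-- The asymptotic displacement of `x` under the powers of an isometry `g`, computed along the
powers of two; it does not depend on `x`. -/
noncomputable def asymptoticDisplacement (x : X) (g : G) : ℝ :=
  ⨅ n : ℕ, dist x (g ^ 2 ^ n • x) / 2 ^ n

theorem bddBelow_displacement (x : X) (g : G) :
    BddBelow (Set.range fun n : ℕ => dist x (g ^ 2 ^ n • x) / 2 ^ n) :=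
  ⟨0, by rintro _ ⟨n, rfl⟩; positivity⟩

theorem asymptoticDisplacement_le (x : X) (g : G) : asymptoticDisplacement x g ≤ dist x (g • x) :=
  (ciInf_le (bddBelow_displacement x g) 0).trans (by simp)

variable [IsIsometricSMul G X]

theorem dist_sq_smul_le (x : X) (g : G) : dist x (g ^ 2 • x) ≤ 2 * dist x (g • x) := by
  have := dist_triangle x (g • x) (g ^ 2 • x)
  rw [pow_two, mul_smul, dist_smul] at this
  rw [pow_two, mul_smul]
  linarith

theorem tendsto_asymptoticDisplacement (x : X) (g : G) :
    Tendsto (fun n : ℕ => dist x (g ^ 2 ^ n • x) / 2 ^ n) atTop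
      (𝓝 (asymptoticDisplacement x g)) := by
  refine tendsto_atTop_ciInf (antitone_nat_of_succ_le fun n => ?_) (bddBelow_displacement x g)
  rw [div_le_div_iff₀ (by positivity) (by positivity)]
  have := dist_sq_smul_le x (g ^ 2 ^ n)
  rw [← pow_mul, ← pow_succ] at this
  calc _ ≤ 2 * dist x (g ^ 2 ^ n • x) * 2 ^ n := by gcongr
    _ = _ := by ring

theorem asymptoticDisplacement_eq (x y : X) (g : G) :
    asymptoticDisplacement x g = asymptoticDisplacement y g := by
  refine tendsto_nhds_unique ((tendsto_iff_of_dist ?_).1 (tendsto_asymptoticDisplacement x g))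
    (tendsto_asymptoticDisplacement y g)
  have h : Tendsto (fun n : ℕ => 2 * dist x y * (1 / 2 : ℝ) ^ n) atTop (𝓝 (2 * dist x y * 0)) :=
    (tendsto_pow_atTop_nhds_zero_of_lt_one (by norm_num) (by norm_num)).const_mul _
  rw [mul_zero] at h
  refine squeeze_zero (fun _ => dist_nonneg) (fun n => ?_) h
  rw [Real.dist_eq, ← sub_div, abs_div, abs_of_pos (a := (2 : ℝ) ^ n) (by positivity),
    one_div, inv_pow, ← div_eq_mul_inv]
  gcongr
  rw [abs_le]
  have h1 := dist_triangle4 x y (g ^ 2 ^ n • y) (g ^ 2 ^ n • x)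
  have h2 := dist_triangle4 y x (g ^ 2 ^ n • x) (g ^ 2 ^ n • y)
  rw [dist_smul] at h1 h2
  rw [dist_comm y x] at h1 h2
  constructor <;> linarith

theorem asymptoticDisplacement_sq (x : X) (g : G) :
    asymptoticDisplacement x (g ^ 2) = 2 * asymptoticDisplacement x g := by
  refine tendsto_nhds_unique (tendsto_asymptoticDisplacement x (g ^ 2)) ?_
  refine (((tendsto_asymptoticDisplacement x g).comp (tendsto_add_atTop_nat 1)).const_mul
    2).congr fun n => ?_
  simp only [Function.comp]
  rw [← pow_mul, ← pow_succ']
  field_simp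
  ring

/-- A set invariant under an isometry `b` and under midpoints contains points whose displacement is
close to the asymptotic displacement. -/
theorem exists_dist_smul_le_div (hX : IsCAT0 X) {C : Set X}
    (hmid : ∀ x ∈ C, ∀ y ∈ C, ∀ m, dist x m = 1 / 2 * dist x y → dist m y = 1 / 2 * dist x y →
      m ∈ C) {x : X} (hx : x ∈ C) (n : ℕ) (b : G) (hb : ∀ y ∈ C, b • y ∈ C) :
    ∃ y ∈ C, dist y (b • y) ≤ dist x (b ^ 2 ^ n • x) / 2 ^ n := by
  induction n generalizing b with
  | zero => exact ⟨x, hx, by simp⟩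
  | succ n ih =>
    obtain ⟨y, hyC, hy⟩ := ih (b ^ 2) fun y hy => by
      rw [pow_two, mul_smul]; exact hb _ (hb _ hy)
    -- `b` carries the midpoint of `y, b y` to that of `b y, b² y`, so `m` moves at most half as far
    -- under `b` as `y` does under `b²`.
    obtain ⟨m, h1, h2⟩ := hX.exists_midpoint y (b • y)
    refine ⟨m, hmid _ hyC _ (hb _ hyC) m h1 h2, ?_⟩
    have := hX.dist_midpoint_le_of_common (p := b • y) (x := y) (y := b ^ 2 • y) (m := m)
      (n := b • m) (by rw [dist_comm, h2, dist_comm]) (by rw [dist_comm, h1, dist_comm])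
      (by rw [dist_smul, h1, pow_two, mul_smul, dist_smul])
      (by rw [pow_two, mul_smul, dist_smul, dist_smul, h2])
    rw [← pow_mul, ← pow_succ'] at hy
    rw [pow_succ (2 : ℝ), ← div_div]
    linarith

/-- Points almost minimal for the elements already treated form a set closed under midpoints, by
convexity, and invariant under the next element, by commutativity. The search for an almost minimal
point of the next element can therefore stay inside this set. -/
theorem exists_forall_mem_dist_smul_le (hX : IsCAT0 X) {A : Type*} [CommGroup A] (α : A →* G)
    (x₀ : X) (S : Finset A) {ε : ℝ} (hε : 0 < ε) :
    ∃ x : X, ∀ s ∈ S, dist x (α s • x) ≤ asymptoticDisplacement x₀ (α s) + ε := by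
  classical
  induction S using Finset.induction_on with
  | empty => exact ⟨x₀, by simp⟩
  | insert b S _ ih =>
    obtain ⟨x, hx⟩ := ih
    have hlim := tendsto_asymptoticDisplacement x (α b)
    rw [asymptoticDisplacement_eq x x₀] at hlim
    obtain ⟨n, hn⟩ := (hlim.eventually (gt_mem_nhds (lt_add_of_pos_right _ hε))).exists
    obtain ⟨y, hyC, hy⟩ := exists_dist_smul_le_div hX
      (C := {x | ∀ s ∈ S, dist x (α s • x) ≤ asymptoticDisplacement x₀ (α s) + ε})
      (fun y hy z hz m h1 h2 s hs => by
        have := hX.dist_midpoint_le h1 h2 (x' := α s • y) (y' := α s • z) (m' := α s • m)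
          (by rw [dist_smul, dist_smul, h1]) (by rw [dist_smul, dist_smul, h2])
        linarith [hy s hs, hz s hs]) hx n (α b)
      (fun y hy s hs => by
        rw [← mul_smul, ← map_mul, mul_comm s b, map_mul, mul_smul, dist_smul]
        exact hy s hs)
    refine ⟨y, fun s hs => ?_⟩
    rcases Finset.mem_insert.1 hs with rfl | hs
    · exact hy.trans hn.le
    · exact hyC s hs

/-- The elements of a finitely generated abelian group have a common minimal displacement point. -/
theorem IsGeometricAction.exists_forall_dist_smul_eq [ProperSpace X] (hX : IsCAT0 X)
    (hG : IsGeometricAction G X) {A : Type*} [CommGroup A] [Countable A] [Group.FG A]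
    (α : A →* G) (x₀ : X) :
    ∃ x : X, ∀ a, dist x (α a • x) = asymptoticDisplacement x₀ (α a) := by
  classical
  obtain ⟨S, hS, hfin⟩ := Group.fg_iff.1 ‹Group.FG A›
  lift S to Finset A using hfin
  obtain ⟨e, he⟩ := exists_surjective_nat A
  -- The generators keep displacements bounded for the compactness argument; the growing initial
  -- pieces of the enumeration ensure that every element is minimal in the limit.
  have hx : ∀ n : ℕ, ∃ x : X, ∀ s ∈ S ∪ (Finset.range (n + 1)).image e,
      dist x (α s • x) ≤ asymptoticDisplacement x₀ (α s) + 1 / ((n : ℝ) + 1) := fun n =>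
    exists_forall_mem_dist_smul_le hX α x₀ _ (by positivity)
  choose x hx using hx
  obtain ⟨R, hR⟩ := (Set.finite_range fun s : S => asymptoticDisplacement x₀ (α s)).bddAbove
  obtain ⟨φ, g, y, hφ, hconj, hy⟩ := hG.exists_conj_subseq (fun s : S => α s) x (R := R + 1)
    (fun s n => by
      refine (hx n s (Finset.mem_union_left _ s.2)).trans (add_le_add (hR ⟨s, rfl⟩) ?_)
      rw [div_le_one (by positivity)]
      linarith [(Nat.cast_nonneg n : (0 : ℝ) ≤ n)])
  -- Conjugations agreeing on generators agree on all of `A`, so one limit point serves every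
  -- element.
  have hconj' : ∀ a n, g n * α a * (g n)⁻¹ = g 0 * α a * (g 0)⁻¹ := by
    intro a n
    have : (MulAut.conj (g n)).toMonoidHom.comp α = (MulAut.conj (g 0)).toMonoidHom.comp α :=
      MonoidHom.eq_of_eqOn_dense hS fun s hs => by simpa using hconj ⟨s, hs⟩ n 0
    simpa using DFunLike.congr_fun this a
  refine ⟨(g 0)⁻¹ • y, fun a => le_antisymm ?_ ?_⟩
  · have h1 : dist ((g 0)⁻¹ • y) (α a • (g 0)⁻¹ • y) = dist y ((g 0 * α a * (g 0)⁻¹) • y) := by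
      rw [← dist_smul (g 0), smul_inv_smul, mul_smul, mul_smul]
    rw [h1]
    have h2 : Tendsto (fun n => asymptoticDisplacement x₀ (α a) + 1 / ((φ n : ℝ) + 1)) atTop
        (𝓝 (asymptoticDisplacement x₀ (α a) + 0)) :=
      tendsto_const_nhds.add (tendsto_one_div_add_atTop_nhds_zero_nat.comp hφ.tendsto_atTop)
    rw [add_zero] at h2
    refine le_of_tendsto_of_tendsto (hy.dist
      ((isometry_smul X (g 0 * α a * (g 0)⁻¹)).continuous.continuousAt.tendsto.comp hy)) h2 ?_
    obtain ⟨N, rfl⟩ := he a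
    filter_upwards [hφ.tendsto_atTop.eventually_ge_atTop N] with n hn
    simp only [Function.comp]
    rw [← hconj' _ n, mul_smul, mul_smul, inv_smul_smul, dist_smul]
    exact hx _ _ (Finset.mem_union_right _ (Finset.mem_image_of_mem _
      (Finset.mem_range.2 (Nat.lt_succ_of_le hn))))
  · rw [asymptoticDisplacement_eq x₀ ((g 0)⁻¹ • y)]
    exact asymptoticDisplacement_le _ _

end TranslationLength

/-! ### Parallelogram law on a lattice and Euclidean seminorms. -/

section IntegralQuadraticForm

open Filter Topology
open scoped MatrixOrder Matrix.Norms.L2Operator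

/-- Jordan–von Neumann: a function on an abelian group obeying the parallelogram law polarises to a
biadditive function. -/
theorem polar_add_left_of_parallelogram {A : Type*} [AddCommGroup A] {q : A → ℝ}
    (hq : ∀ a b, q (a + b) + q (a - b) = 2 * q a + 2 * q b) (u v y : A) :
    q (u + v + y) - q (u + v - y) = (q (u + y) - q (u - y)) + (q (v + y) - q (v - y)) := by
  have hneg : ∀ y, q (-y) = q y := by
    intro y
    have h1 := hq 0 0
    have h2 := hq 0 y
    simp only [add_zero, sub_zero, zero_add, zero_sub] at h1 h2
    linarith
  have key : ∀ x z, (q (x + z + y) - q (x + z - y)) + (q (x - z + y) - q (x - z - y)) =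
      2 * (q (x + y) - q (x - y)) := by
    intro x z
    have h1 := hq (x + y) z
    have h2 := hq (x - y) z
    rw [show x + y + z = x + z + y by abel, show x + y - z = x - z + y by abel] at h1
    rw [show x - y + z = x + z - y by abel, show x - y - z = x - z - y by abel] at h2
    linarith
  have hdouble : ∀ x, q (x + x + y) - q (x + x - y) = 2 * (q (x + y) - q (x - y)) := by
    intro x
    have := key x x
    rw [sub_self, zero_add, zero_sub, hneg, sub_self, add_zero] at this
    exact this
  -- The sum and difference of `u + v` and `u - v` are `2u` and `2v`, to which doubling applies.
  have h := key (u + v) (u - v)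
  rw [show u + v + (u - v) = u + u by abel, show u + v - (u - v) = v + v by abel] at h
  linarith [hdouble u, hdouble v]

/-- The biadditive form obtained by polarisation. -/
noncomputable def polarHom {A : Type*} [AddCommGroup A] {q : A → ℝ}
    (hq : ∀ a b, q (a + b) + q (a - b) = 2 * q a + 2 * q b) : A →+ A →+ ℝ :=
  AddMonoidHom.mk' (fun a => AddMonoidHom.mk' (fun b => (q (b + a) - q (b - a)) / 4)
    fun b c => by rw [polar_add_left_of_parallelogram hq]; ring) fun a b => by
      have hneg : ∀ y, q (-y) = q y := by
        intro y
        have h1 := hq 0 0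
        have h2 := hq 0 y
        simp only [add_zero, sub_zero, zero_add, zero_sub] at h1 h2
        linarith
      ext c
      simp only [AddMonoidHom.mk'_apply, AddMonoidHom.add_apply]
      have := polar_add_left_of_parallelogram hq a b c
      rw [← hneg (a + b - c), ← hneg (a - c), ← hneg (b - c), neg_sub, neg_sub, neg_sub] at this
      rw [add_comm c, add_comm c, add_comm c, this]
      ring

theorem polarHom_self {A : Type*} [AddCommGroup A] {q : A → ℝ}
    (hq : ∀ a b, q (a + b) + q (a - b) = 2 * q a + 2 * q b) (a : A) : polarHom hq a a = q a := by
  have h1 := hq 0 0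
  have h2 := hq a a
  simp only [add_zero, sub_self] at h1 h2
  simp only [polarHom, AddMonoidHom.mk'_apply, sub_self]
  linarith

theorem polarHom_comm {A : Type*} [AddCommGroup A] {q : A → ℝ}
    (hq : ∀ a b, q (a + b) + q (a - b) = 2 * q a + 2 * q b) (a b : A) :
    polarHom hq a b = polarHom hq b a := by
  have h1 := polarHom_self hq (a + b)
  have h2 := polarHom_self hq (a - b)
  have h3 := hq a b
  rw [← h1, ← h2, ← polarHom_self hq a, ← polarHom_self hq b] at h3
  simp only [map_add, map_sub, AddMonoidHom.add_apply, AddMonoidHom.sub_apply,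
    polarHom_self] at h1 h2
  have h4 : polarHom hq b a = (q (a + b) - q (a - b)) / 4 := rfl
  linarith

theorem tendsto_floor_mul_div (x : ℝ) :
    Tendsto (fun t : ℕ => (⌊(t : ℝ) * x⌋ : ℝ) / t) atTop (𝓝 x) := by
  rw [tendsto_iff_dist_tendsto_zero]
  refine squeeze_zero' (Eventually.of_forall fun _ => dist_nonneg) ?_
    tendsto_one_div_atTop_nhds_zero_nat
  filter_upwards [eventually_gt_atTop 0] with t ht
  have ht' : (0 : ℝ) < t := by exact_mod_cast ht
  rw [Real.dist_eq, show (⌊(t : ℝ) * x⌋ : ℝ) / t - x = -(Int.fract (t * x)) / t by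
    rw [Int.fract]; field_simp; ring, abs_div, abs_neg, abs_of_pos ht']
  gcongr
  rw [abs_of_nonneg (Int.fract_nonneg _)]
  exact (Int.fract_lt_one _).le

/-- A nonnegative function on `ℤ ^ k` whose square obeys the parallelogram law is the restriction
of a Euclidean seminorm. -/
theorem exists_linearMap_norm_eq {k : ℕ} {N : (Fin k → ℤ) → ℝ} (hN : ∀ n, 0 ≤ N n)
    (hq : ∀ a b, N (a + b) ^ 2 + N (a - b) ^ 2 = 2 * N a ^ 2 + 2 * N b ^ 2) :
    ∃ T : (Fin k → ℝ) →ₗ[ℝ] EuclideanSpace ℝ (Fin k), ∀ n, ‖T fun i => (n i : ℝ)‖ = N n := by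
  set B := polarHom (q := fun a => N a ^ 2) hq with hB
  set M : Matrix (Fin k) (Fin k) ℝ :=
    Matrix.of fun i j => B (Pi.single i 1) (Pi.single j 1) with hM
  have hsum : ∀ n : Fin k → ℤ, (fun i => (n i : ℝ)) ⬝ᵥ M.mulVec (fun i => (n i : ℝ)) = N n ^ 2 := by
    intro n
    have h1 : B n n = N n ^ 2 := polarHom_self hq n
    have h2 : n = ∑ i, n i • (Pi.single i 1 : Fin k → ℤ) := by
      ext j
      simp [Finset.sum_apply, Pi.single_apply]
    rw [← h1]
    conv_rhs => rw [h2]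
    have h3 : ∀ i j, B (n i • Pi.single i 1) (n j • Pi.single j 1) = n i * (M i j * n j) := by
      intro i j
      rw [map_zsmul, map_zsmul, AddMonoidHom.smul_apply, zsmul_eq_mul, zsmul_eq_mul, hM,
        Matrix.of_apply]
      ring
    simp only [map_sum, AddMonoidHom.finsetSum_apply, h3, dotProduct, Matrix.mulVec,
      Finset.mul_sum]
    exact Finset.sum_comm
  have hpos : M.PosSemidef := by
    refine Matrix.PosSemidef.of_dotProduct_mulVec_nonneg ?_ fun x => ?_
    · ext i j
      simpa [hM] using polarHom_comm hq _ _
    -- The form is nonnegative at integral points, hence at rational multiples of them, and these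
    -- approximate every real vector.
    · have hcont : Continuous fun x : Fin k → ℝ => x ⬝ᵥ M.mulVec x :=
        Continuous.dotProduct continuous_id (Continuous.matrix_mulVec continuous_const continuous_id)
      have hlim : Tendsto (fun t : ℕ => fun i => (⌊(t : ℝ) * x i⌋ : ℝ) / t) atTop (𝓝 x) :=
        tendsto_pi_nhds.2 fun i => tendsto_floor_mul_div (x i)
      refine ge_of_tendsto' ((hcont.tendsto x).comp hlim) fun t => ?_
      have h1 : (fun i => (⌊(t : ℝ) * x i⌋ : ℝ) / t) =
          (1 / (t : ℝ)) • fun i => ((fun i => ⌊(t : ℝ) * x i⌋ : Fin k → ℤ) i : ℝ) := by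
        ext i
        simp [div_eq_inv_mul]
      simp only [Function.comp]
      rw [h1, Matrix.mulVec_smul, dotProduct_smul, smul_dotProduct, hsum]
      simp only [smul_eq_mul]
      positivity
  obtain ⟨C, hC⟩ : ∃ C : Matrix (Fin k) (Fin k) ℝ, M = C.conjTranspose * C := by
    obtain ⟨C, hC⟩ := CStarAlgebra.nonneg_iff_eq_star_mul_self.mp hpos.nonneg
    exact ⟨C, hC⟩
  refine ⟨(WithLp.linearEquiv 2 ℝ (Fin k → ℝ)).symm.toLinearMap ∘ₗ C.mulVecLin, fun n => ?_⟩
  rw [← abs_of_nonneg (hN n), ← abs_of_nonneg (norm_nonneg _), ← sq_eq_sq_iff_abs_eq_abs, ← hsum n,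
    EuclideanSpace.norm_sq_eq, hC]
  rw [← Matrix.mulVec_mulVec, Matrix.dotProduct_mulVec, Matrix.vecMul_conjTranspose]
  simp [dotProduct, pow_two]

end IntegralQuadraticForm

/-! ### From an isometric lattice to a flat. -/

section LatticeExtension

open Filter Topology

/-- This is a Busemann function limit: write the difference as `(2⟨w, e⟩ + ‖e‖²) / (‖w + e‖ + ‖w‖)`
and rescale by `1/t`. -/
theorem tendsto_norm_add_sub_norm {E : Type*} [NormedAddCommGroup E] [InnerProductSpace ℝ E]
    {w : ℕ → E} {u : E} (hu : u ≠ 0)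
    (hw : Tendsto (fun t : ℕ => (t : ℝ)⁻¹ • w t) atTop (𝓝 u)) (e : E) :
    Tendsto (fun t => ‖w t + e‖ - ‖w t‖) atTop (𝓝 (inner ℝ u e / ‖u‖)) := by
  have hinv : Tendsto (fun t : ℕ => (t : ℝ)⁻¹) atTop (𝓝 0) := tendsto_inv_atTop_nhds_zero_nat
  have hnum : Tendsto (fun t : ℕ => 2 * inner ℝ ((t : ℝ)⁻¹ • w t) e + (t : ℝ)⁻¹ * ‖e‖ ^ 2) atTop
      (𝓝 (2 * inner ℝ u e + 0 * ‖e‖ ^ 2)) :=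
    ((hw.inner tendsto_const_nhds).const_mul 2).add (hinv.mul_const _)
  have hden : Tendsto (fun t : ℕ => ‖(t : ℝ)⁻¹ • w t + (t : ℝ)⁻¹ • e‖ + ‖(t : ℝ)⁻¹ • w t‖) atTop
      (𝓝 (‖u + (0 : ℝ) • e‖ + ‖u‖)) := (hw.add (hinv.smul_const e)).norm.add hw.norm
  have hu' : 0 < ‖u‖ := norm_pos_iff.2 hu
  simp only [zero_smul, add_zero, zero_mul] at hnum hden
  have hlim := hnum.div hden (by positivity)
  rw [← two_mul, mul_div_mul_left _ _ two_ne_zero] at hlim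
  refine hlim.congr' ?_
  filter_upwards [eventually_gt_atTop 0, hden.eventually_ne (by positivity : ‖u‖ + ‖u‖ ≠ 0)]
    with t ht hne
  have ht' : (0 : ℝ) < (t : ℝ)⁻¹ := by positivity
  simp only [Pi.div_apply]
  rw [div_eq_iff hne, ← smul_add, norm_smul, norm_smul, inner_smul_left, Real.norm_eq_abs,
    abs_of_pos ht', ← mul_add]
  have h := norm_add_sq_real (w t) e
  simp only [conj_trivial]
  linear_combination (-(t : ℝ)⁻¹) * h

/-- A lattice of Euclidean points in a complete `CAT(0)` space spans a flat. -/
theorem IsCAT0.exists_isometry_of_lattice {X : Type*} [MetricSpace X] [CompleteSpace X]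
    (hX : IsCAT0 X) {E : Type*} [NormedAddCommGroup E] [InnerProductSpace ℝ E] {k : ℕ}
    (T : (Fin k → ℝ) ≃ₗ[ℝ] E) (σ : (Fin k → ℤ) → X)
    (hσ : ∀ a b, dist (σ a) (σ b) = ‖T (fun i => (a i : ℝ)) - T (fun i => (b i : ℝ))‖) :
    ∃ Φ : E → X, Isometry Φ := by
  have hTc : Continuous T := T.toLinearMap.continuous_of_finiteDimensional
  set c : (Fin k → ℤ) → E := fun n => T fun i => (n i : ℝ) with hc
  have hc0 : c 0 = 0 := by simp [hc, ← Pi.zero_def]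
  have hσ0 : ∀ a, dist (σ 0) (σ a) = ‖c a‖ := fun a => by
    rw [hσ]; change ‖c 0 - c a‖ = _; rw [hc0, zero_sub, norm_neg]
  set fl : ℕ → E → Fin k → ℤ := fun t e i => ⌊(t : ℝ) * T.symm e i⌋ with hfl
  have hlim : ∀ e, Tendsto (fun t : ℕ => (t : ℝ)⁻¹ • c (fl t e)) atTop (𝓝 e) := by
    intro e
    have h1 : Tendsto (fun t : ℕ => fun i => (⌊(t : ℝ) * T.symm e i⌋ : ℝ) / t) atTop
        (𝓝 (T.symm e)) := tendsto_pi_nhds.2 fun i => tendsto_floor_mul_div _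
    have h2 := (hTc.tendsto _).comp h1
    rw [T.apply_symm_apply] at h2
    refine h2.congr fun t => ?_
    simp only [Function.comp, hc, hfl, ← map_smul]
    congr 1
    ext i
    simp [div_eq_inv_mul]
  have hunit : ∀ t : ℕ, (t : ℝ)⁻¹ ∈ Set.Icc (0 : ℝ) 1 := fun t =>
    ⟨by positivity, Nat.cast_inv_le_one t⟩
  have hcomp : ∀ {a b : Fin k → ℤ} {l r : ℝ} {m n : X}, l ∈ Set.Icc (0 : ℝ) 1 →
      r ∈ Set.Icc (0 : ℝ) 1 → dist (σ 0) m = l * dist (σ 0) (σ a) →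
      dist m (σ a) = (1 - l) * dist (σ 0) (σ a) → dist (σ 0) n = r * dist (σ 0) (σ b) →
      dist n (σ b) = (1 - r) * dist (σ 0) (σ b) → dist m n ≤ dist (l • c a) (r • c b) := by
    intro a b l r m n hl hr h1 h2 h3 h4
    have h := hX.dist_sq_le hl hr h1 h2 h3 h4
    rw [hσ0, hσ0, hσ] at h
    refine le_of_sq_le_sq (h.trans_eq ?_) dist_nonneg
    change _ - l * r * (_ - ‖c a - c b‖ ^ 2) = _
    rw [dist_eq_norm, norm_sub_sq_real, norm_sub_sq_real, norm_smul, norm_smul, inner_smul_left,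
      inner_smul_right, mul_pow, mul_pow, Real.norm_eq_abs, Real.norm_eq_abs, sq_abs, sq_abs]
    simp only [conj_trivial]
    ring
  -- `y t e` approximates the image of `e`: go the fraction `1/t` of the way to a lattice point near
  -- `t e`.
  choose y hy1 hy2 _ using fun (t : ℕ) (e : E) =>
    hX.exists_stewart (σ 0) (σ (fl t e)) (hunit t)
  have hyd : ∀ s t e e', dist (y s e) (y t e') ≤
      dist ((s : ℝ)⁻¹ • c (fl s e)) ((t : ℝ)⁻¹ • c (fl t e')) := fun s t e e' =>
    hcomp (hunit s) (hunit t) (hy1 s e) (hy2 s e) (hy1 t e') (hy2 t e')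
  have hcauchy : ∀ e, CauchySeq fun t => y t e := by
    intro e
    rw [Metric.cauchySeq_iff]
    intro ε hε
    obtain ⟨N, hN⟩ := Metric.cauchySeq_iff.1 (hlim e).cauchySeq ε hε
    exact ⟨N, fun m hm n hn => (hyd m n e e).trans_lt (hN m hm n hn)⟩
  choose Φ hΦ using fun e => cauchySeq_tendsto_of_complete (hcauchy e)
  have hle : ∀ e e', dist (Φ e) (Φ e') ≤ dist e e' := fun e e' =>
    le_of_tendsto_of_tendsto' ((hΦ e).dist (hΦ e')) ((hlim e).dist (hlim e')) fun t => hyd t t e e'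
  have hσle : ∀ n e, dist (σ n) (Φ e) ≤ dist (c n) e := by
    intro n e
    refine le_of_tendsto_of_tendsto' (tendsto_const_nhds.dist (hΦ e))
      (tendsto_const_nhds.dist (hlim e)) fun t => ?_
    have := hcomp (a := n) (l := 1) (m := σ n) (by norm_num) (hunit t) (by simp) (by simp)
      (hy1 t e) (hy2 t e)
    rwa [one_smul] at this
  refine ⟨Φ, Isometry.of_dist_eq fun e e' => le_antisymm (hle e e') ?_⟩
  rcases eq_or_ne e' e with rfl | hne
  · simp
  -- For the lower bound, pass from one lattice point to its opposite, far out in the directions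
  -- `-u` and `u`, via `Φ e` and `Φ e'`. The triangle inequality loses nothing in the limit.
  set u := e' - e with hu
  have hu0 : u ≠ 0 := sub_ne_zero.2 hne
  have hupos : 0 < ‖u‖ := norm_pos_iff.2 hu0
  set w : ℕ → E := fun t => c (fl t u) with hw
  have h1 := tendsto_norm_add_sub_norm hu0 (hlim u) e
  have h2 := tendsto_norm_add_sub_norm hu0 (hlim u) (-e')
  have h3 := (h1.add h2).neg
  have h4 : -(inner ℝ u e / ‖u‖ + inner ℝ u (-e') / ‖u‖) = dist e e' := by
    rw [← add_div, ← inner_add_right, ← neg_div, ← inner_neg_right,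
      show -(e + -e') = u by rw [hu]; abel, real_inner_self_eq_norm_sq, pow_two,
      mul_div_assoc, div_self hupos.ne', mul_one, dist_comm, dist_eq_norm]
  rw [h4] at h3
  refine le_of_tendsto' h3 fun t => ?_
  have hcneg : c (-fl t u) = -c (fl t u) := by
    simp only [hc, ← map_neg]
    congr 1
    ext i
    simp
  have d1 := hσle (-fl t u) e
  have d2 := hσle (fl t u) e'
  have d3 : dist (σ (-fl t u)) (σ (fl t u)) = 2 * ‖c (fl t u)‖ := by
    rw [hσ]
    change ‖c _ - c _‖ = _
    rw [hcneg, ← neg_add', norm_neg, ← two_smul ℝ, norm_smul]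
    simp
  have d4 := dist_triangle4 (σ (-fl t u)) (Φ e) (Φ e') (σ (fl t u))
  rw [hcneg, dist_eq_norm, ← neg_add', norm_neg] at d1
  rw [dist_eq_norm, sub_eq_add_neg] at d2
  rw [dist_comm (Φ e')] at d4
  linarith

end LatticeExtension

/-! ### The Flat Torus Theorem. -/

section FlatOfFreeAbelian

open Filter Topology

/-- A linear map which is proper on the integral points is injective. -/
theorem injective_of_finite_norm_le {k : ℕ} {E : Type*} [NormedAddCommGroup E] [NormedSpace ℝ E]
    (T : (Fin k → ℝ) →ₗ[ℝ] E)
    (hT : ∀ R : ℝ, {n : Fin k → ℤ | ‖T fun i => (n i : ℝ)‖ ≤ R}.Finite) :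
    Function.Injective T := by
  rw [injective_iff_map_eq_zero]
  intro v hv
  set T' := T.toContinuousLinearMap
  set n : ℕ → Fin k → ℤ := fun t i => ⌊(t : ℝ) * v i⌋ with hn
  -- If `T v = 0`, the integer parts of `t v` have the same images as bounded fractional parts, up
  -- to sign; so they take finitely many values and `v` must vanish.
  have hbound : ∀ t, ‖T fun i => (n t i : ℝ)‖ ≤ ‖T'‖ := by
    intro t
    have h1 : (fun i => (n t i : ℝ)) = (t : ℝ) • v + fun i => -Int.fract ((t : ℝ) * v i) := by
      ext i
      simp [hn, ← Int.self_sub_fract, sub_eq_add_neg]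
    rw [h1, map_add, map_smul, hv, smul_zero, zero_add]
    refine (T'.le_opNorm _).trans (mul_le_of_le_one_right (norm_nonneg _) ?_)
    rw [pi_norm_le_iff_of_nonneg zero_le_one]
    intro i
    rw [norm_neg, Real.norm_eq_abs, abs_of_nonneg (Int.fract_nonneg _)]
    exact (Int.fract_lt_one _).le
  ext i
  have h1 : Tendsto (fun t : ℕ => (n t i : ℝ) / t) atTop (𝓝 (v i)) := tendsto_floor_mul_div (v i)
  obtain ⟨C, hC⟩ := ((hT ‖T'‖).image fun n => |(n i : ℝ)|).bddAbove
  refine tendsto_nhds_unique h1 (squeeze_zero_norm (a := fun t : ℕ => C / t) (fun t => ?_)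
    (tendsto_const_div_atTop_nhds_zero_nat C))
  rw [norm_div, Real.norm_eq_abs, Real.norm_natCast]
  gcongr
  exact hC ⟨n t, hbound t, rfl⟩

theorem IsGeometricAction.exists_isometry_of_injective {G X : Type*} [Group G] [MetricSpace X]
    [Nonempty X] [MulAction G X] (hX : IsCAT0 X) (hG : IsGeometricAction G X) {k : ℕ}
    (α : Multiplicative (Fin k → ℤ) →* G) (hα : Function.Injective α) :
    ∃ Φ : EuclideanSpace ℝ (Fin k) → X, Isometry Φ := by
  have := hG.isometric
  have := hG.properSpace hX
  have : Group.FG (Multiplicative (Fin k → ℤ)) := inferInstance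
  have : Countable (Multiplicative (Fin k → ℤ)) := inferInstanceAs (Countable (Fin k → ℤ))
  obtain ⟨x₀⟩ := ‹Nonempty X›
  obtain ⟨x, hx⟩ := hG.exists_forall_dist_smul_eq hX α x₀
  set σ : (Fin k → ℤ) → X := fun a => α (.ofAdd a) • x with hσ
  set N : (Fin k → ℤ) → ℝ := fun a => dist x (σ a) with hN
  have hd : ∀ a b, dist (σ a) (σ b) = N (b - a) := by
    intro a b
    simp only [hN, hσ]
    rw [← dist_smul (α (.ofAdd a)) x, ← mul_smul, ← map_mul, ← ofAdd_add, add_sub_cancel]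
  have hdouble : ∀ a, N (a + a) = 2 * N a := by
    intro a
    simp only [hN, hσ]
    rw [hx, hx, ofAdd_add, map_mul, ← pow_two, asymptoticDisplacement_sq]
  have hneg : ∀ a, N (-a) = N a := by
    intro a
    have h1 := hd a 0
    have h2 := hd 0 a
    rw [zero_sub] at h1
    rw [sub_zero] at h2
    rw [← h1, ← h2, dist_comm]
  have hCN : ∀ a b, 2 * N a ^ 2 + 2 * N b ^ 2 ≤ N (a + b) ^ 2 + N (a - b) ^ 2 := by
    intro a b
    -- Doubling makes `σ a` the midpoint of `σ 0` and `σ (a + a)`.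
    have h := hX.stewart (x := σ 0) (y := σ (a + a)) (m := σ a) (l := 1 / 2) (by norm_num)
      (by rw [hd, hd, sub_zero, sub_zero, hdouble]; ring)
      (by rw [hd, hd, sub_zero, add_sub_cancel_right, hdouble]; ring) (σ (a + b))
    rw [hd, hd, hd, hd, sub_zero, sub_zero, hdouble, add_sub_cancel_left,
      show a + b - (a + a) = -(a - b) by abel, hneg] at h
    linarith
  have hpar : ∀ a b, N (a + b) ^ 2 + N (a - b) ^ 2 = 2 * N a ^ 2 + 2 * N b ^ 2 := by
    intro a b
    refine le_antisymm ?_ (hCN a b)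
    have h := hCN (a + b) (a - b)
    rw [show a + b + (a - b) = a + a by abel, show a + b - (a - b) = b + b by abel, hdouble,
      hdouble] at h
    linarith
  obtain ⟨T, hT⟩ := exists_linearMap_norm_eq (fun _ => dist_nonneg) hpar
  -- Properness of the action upgrades the seminorm to a norm.
  have hinj : Function.Injective T := by
    refine injective_of_finite_norm_le T fun R => ?_
    refine Set.Finite.subset ((hG.finite_dist_smul_le x R).preimage
      (f := fun a : Fin k → ℤ => α (.ofAdd a))
      (hα.comp Multiplicative.ofAdd.injective).injOn) fun n hn => ?_
    rw [Set.mem_ofPred_eq, hT] at hn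
    exact hn
  refine hX.exists_isometry_of_lattice
    (T.linearEquivOfInjective hinj (by simp)) σ fun a b => ?_
  have hTN : ∀ n, ‖T fun i => (n i : ℝ)‖ = N n := hT
  rw [dist_comm, hd, ← hTN, T.linearEquivOfInjective_apply, T.linearEquivOfInjective_apply,
    ← map_sub]
  congr 2
  ext i
  simp

end FlatOfFreeAbelian

/-! ### Maximal stretch of a normal operator. -/

section Crystallographic

open Filter Topology

theorem exists_unit_forall_norm_le {E F : Type*} [NormedAddCommGroup E] [NormedSpace ℝ E]
    [FiniteDimensional ℝ E] [Nontrivial E] [NormedAddCommGroup F] [NormedSpace ℝ F]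
    (T : E →ₗ[ℝ] F) : ∃ x, ‖x‖ = 1 ∧ ∀ y, ‖T y‖ ≤ ‖T x‖ * ‖y‖ := by
  have := FiniteDimensional.proper_real E
  have hT : Continuous T := T.continuous_of_finiteDimensional
  obtain ⟨x, hx, hmax⟩ := (isCompact_sphere (0 : E) 1).exists_isMaxOn
    (NormedSpace.sphere_nonempty.2 zero_le_one) (f := fun x => ‖T x‖) (by fun_prop)
  rw [mem_sphere_zero_iff_norm] at hx
  refine ⟨x, hx, fun y => ?_⟩
  rcases eq_or_ne y 0 with rfl | hy
  · simp
  have hy' : 0 < ‖y‖ := norm_pos_iff.2 hy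
  have h := hmax (show ‖y‖⁻¹ • y ∈ Metric.sphere (0 : E) 1 by
    rw [mem_sphere_zero_iff_norm, norm_smul, norm_inv, norm_norm, inv_mul_cancel₀ hy'.ne'])
  simp only [Set.mem_ofPred_eq, map_smul, norm_smul, norm_inv, norm_norm] at h
  rwa [inv_mul_le_iff₀ hy', mul_comm] at h

variable {E : Type*} [NormedAddCommGroup E] [InnerProductSpace ℝ E] [FiniteDimensional ℝ E]

/-- A nonzero normal operator splits orthogonally into a part on which it is a multiple of an
isometry, by its norm, and a part on which its norm is smaller. -/
theorem exists_splitting_of_normal (N : E →L[ℝ] E) (hN : N ≠ 0)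
    (hnormal : N.adjoint * N = N * N.adjoint) :
    ∃ (P Q : E →L[ℝ] E) (m' : ℝ), 0 ≤ m' ∧ m' < ‖N‖ ∧ (∀ x, P x + Q x = x) ∧
      (∀ x, ‖P x‖ ≤ ‖x‖) ∧ (∀ x, ‖Q x‖ ≤ ‖x‖) ∧
      (∀ x, P (N x) = N (P x)) ∧ (∀ x, Q (N x) = N (Q x)) ∧
      (∀ x, ‖N (P x)‖ = ‖N‖ * ‖P x‖) ∧ (∀ x, ‖N (Q x)‖ ≤ m' * ‖Q x‖) ∧
      ∃ u, ‖u‖ = 1 ∧ P u = u ∧ Q u = 0 := by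
  set m := ‖N‖ with hm
  have hmpos : 0 < m := norm_pos_iff.2 hN
  have : Nontrivial E := by
    by_contra h
    rw [not_nontrivial_iff_subsingleton] at h
    exact hN (Subsingleton.elim _ _)
  set S := N.adjoint * N with hS
  have hinner : ∀ x, inner ℝ (S x) x = ‖N x‖ ^ 2 := by
    intro x
    rw [hS, mul_apply_eq_comp, ContinuousLinearMap.adjoint_inner_left,
      real_inner_self_eq_norm_sq]
  -- `W` is the top eigenspace of `N* N`: exactly the vectors that `N` stretches by its full norm.
  set W : Submodule ℝ E := LinearMap.ker (S - (m ^ 2) • (1 : E →L[ℝ] E)).toLinearMap with hW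
  have hmemW : ∀ x, x ∈ W ↔ S x = (m ^ 2) • x := by
    intro x
    simp [hW, sub_eq_zero]
  have hWmax : ∀ x, ‖N x‖ = m * ‖x‖ → x ∈ W := by
    intro x hx
    rw [hmemW, ← sub_eq_zero, ← norm_eq_zero]
    have h1 : ‖S x‖ ≤ m ^ 2 * ‖x‖ := by
      refine (S.le_opNorm x).trans ?_
      gcongr
      refine (norm_mul_le _ _).trans_eq ?_
      rw [LinearIsometryEquiv.norm_map, pow_two]
    have h2 : ‖S x - (m ^ 2) • x‖ ^ 2 ≤ 0 := by
      rw [norm_sub_sq_real, inner_smul_right, hinner, hx, norm_smul, Real.norm_eq_abs,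
        abs_of_pos (by positivity)]
      nlinarith [mul_self_le_mul_self (norm_nonneg _) h1]
    exact pow_eq_zero_iff two_ne_zero |>.1 (le_antisymm h2 (sq_nonneg _))
  have hWnorm : ∀ x ∈ W, ‖N x‖ = m * ‖x‖ := by
    intro x hx
    have h1 := hinner x
    rw [(hmemW x).1 hx, inner_smul_left, real_inner_self_eq_norm_sq] at h1
    simp only [conj_trivial] at h1
    rw [← mul_pow] at h1
    exact ((sq_eq_sq₀ (by positivity) (by positivity)).1 h1).symm
  have hS' : S = N * N.adjoint := hnormal
  have hSN : ∀ x, S (N x) = N (S x) := by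
    intro x
    have : S * N = N * S := by rw [hS', mul_assoc, ← hS, hS']
    exact DFunLike.congr_fun this x
  have hSN' : ∀ x, S (N.adjoint x) = N.adjoint (S x) := by
    intro x
    have : S * N.adjoint = N.adjoint * S := by
      rw [hS, mul_assoc, ← hS', hS]
    exact DFunLike.congr_fun this x
  have hNW : ∀ x ∈ W, N x ∈ W := by
    intro x hx
    rw [hmemW] at hx ⊢
    rw [hSN, hx, map_smul]
  have hNW' : ∀ x ∈ Wᗮ, N x ∈ Wᗮ := by
    intro x hx
    rw [Submodule.mem_orthogonal] at hx ⊢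
    intro w hw
    rw [← ContinuousLinearMap.adjoint_inner_left]
    refine hx _ ?_
    rw [hmemW] at hw ⊢
    rw [hSN', hw, map_smul]
  obtain ⟨m', hm'0, hm'le, hm'⟩ : ∃ m', 0 ≤ m' ∧ m' < m ∧ ∀ x ∈ Wᗮ, ‖N x‖ ≤ m' * ‖x‖ := by
    rcases subsingleton_or_nontrivial Wᗮ with hs | hnt
    · refine ⟨0, le_rfl, hmpos, fun x hx => ?_⟩
      have : (⟨x, hx⟩ : Wᗮ) = 0 := Subsingleton.elim _ _
      obtain rfl : x = 0 := congrArg Subtype.val this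
      simp
    · obtain ⟨x, hx, hmax⟩ := exists_unit_forall_norm_le (N.toLinearMap ∘ₗ Wᗮ.subtype)
      rw [Submodule.coe_norm] at hx
      refine ⟨‖N x‖, norm_nonneg _, ?_, fun y hy => hmax ⟨y, hy⟩⟩
      have hle : ‖N x‖ ≤ m := by
        simpa only [hx, mul_one] using N.le_opNorm (x : E)
      refine lt_of_le_of_ne hle fun heq => ?_
      have hxW : (x : E) ∈ W := hWmax _ (by rw [heq, hx, mul_one])
      have : inner ℝ (x : E) x = 0 := (Submodule.mem_orthogonal _ _).1 x.2 _ hxW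
      rw [inner_self_eq_zero] at this
      simp [this] at hx
  have hsum : ∀ x, W.starProjection x + Wᗮ.starProjection x = x := fun x =>
    Submodule.starProjection_add_starProjection_orthogonal x
  have hPm : ∀ x, W.starProjection x ∈ W := fun x => Submodule.starProjection_apply_mem _ _
  have hQm : ∀ x, Wᗮ.starProjection x ∈ Wᗮ := fun x => Submodule.starProjection_apply_mem _ _
  have hPN : ∀ x, W.starProjection (N x) = N (W.starProjection x) := by
    intro x
    refine Submodule.eq_starProjection_of_mem_of_inner_eq_zero (hNW _ (hPm x)) fun w hw => ?_
    rw [← map_sub]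
    have : x - W.starProjection x = Wᗮ.starProjection x := by
      nth_rewrite 1 [← hsum x]; abel
    rw [this]
    rw [real_inner_comm]
    exact (Submodule.mem_orthogonal _ _).1 (hNW' _ (hQm x)) w hw
  refine ⟨W.starProjection, Wᗮ.starProjection, m', hm'0, hm'le, hsum,
    fun x => Submodule.norm_starProjection_apply_le _ _,
    fun x => Submodule.norm_starProjection_apply_le _ _, hPN, fun x => ?_,
    fun x => hWnorm _ (hPm x), fun x => ?_, ?_⟩
  · have h1 := hsum (N x)
    rw [hPN] at h1
    have h2 : N (W.starProjection x) + N (Wᗮ.starProjection x) = N x := by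
      rw [← map_add, hsum]
    exact add_left_cancel (h1.trans h2.symm)
  · exact hm' _ (hQm x)
  · obtain ⟨u, hu, hmax⟩ := exists_unit_forall_norm_le N.toLinearMap
    have huW : u ∈ W := hWmax u (le_antisymm (N.le_opNorm u) (by
      rw [hu, mul_one]
      exact N.opNorm_le_bound (norm_nonneg _) hmax))
    have h1 : W.starProjection u = u := Submodule.starProjection_eq_self_iff.2 huW
    refine ⟨u, hu, h1, ?_⟩
    have := hsum u
    rw [h1] at this
    simpa using this

end Crystallographic

/-! ### Commutators of affine isometries. -/

section Crystallographic

variable {E : Type*} [NormedAddCommGroup E] [InnerProductSpace ℝ E]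

/-- The linear part of an affine isometry, as a continuous linear map. -/
noncomputable def AffineIsometryEquiv.linearPart (g : E ≃ᵃⁱ[ℝ] E) : E →L[ℝ] E :=
  g.linearIsometryEquiv.toContinuousLinearEquiv.toContinuousLinearMap

namespace AffineIsometryEquiv

theorem apply_eq_linearPart_add (g : E ≃ᵃⁱ[ℝ] E) (x : E) : g x = g.linearPart x + g 0 := by
  have h : g x = g.linearIsometryEquiv x + g 0 := by simpa using g.map_vadd 0 x
  exact h

theorem norm_linearPart_apply (g : E ≃ᵃⁱ[ℝ] E) (x : E) : ‖g.linearPart x‖ = ‖x‖ :=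
  g.linearIsometryEquiv.norm_map x

theorem linearPart_mul (g h : E ≃ᵃⁱ[ℝ] E) :
    (g * h).linearPart = g.linearPart * h.linearPart := rfl

theorem linearPart_one : (1 : E ≃ᵃⁱ[ℝ] E).linearPart = 1 := rfl

theorem linearPart_mul_linearPart_inv (g : E ≃ᵃⁱ[ℝ] E) :
    g.linearPart * (g⁻¹).linearPart = 1 := by
  rw [← linearPart_mul, mul_inv_cancel, linearPart_one]

theorem linearPart_inv_mul_linearPart (g : E ≃ᵃⁱ[ℝ] E) :
    (g⁻¹).linearPart * g.linearPart = 1 := by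
  rw [← linearPart_mul, inv_mul_cancel, linearPart_one]

theorem mul_apply_zero (g h : E ≃ᵃⁱ[ℝ] E) : (g * h) 0 = g.linearPart (h 0) + g 0 :=
  g.apply_eq_linearPart_add (h 0)

theorem norm_linearPart_mul (g : E ≃ᵃⁱ[ℝ] E) (T : E →L[ℝ] E) : ‖g.linearPart * T‖ = ‖T‖ :=
  ContinuousLinearMap.opNorm_ext _ _ fun x => g.norm_linearPart_apply (T x)

theorem norm_mul_linearPart (g : E ≃ᵃⁱ[ℝ] E) (T : E →L[ℝ] E) : ‖T * g.linearPart‖ = ‖T‖ :=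
  T.opNorm_comp_linearIsometryEquiv g.linearIsometryEquiv

theorem norm_linearPart_le (g : E ≃ᵃⁱ[ℝ] E) : ‖g.linearPart‖ ≤ 1 :=
  ContinuousLinearMap.opNorm_le_bound _ zero_le_one fun x => by
    rw [one_mul, norm_linearPart_apply]

theorem inv_apply_zero (g : E ≃ᵃⁱ[ℝ] E) : g⁻¹ 0 = -(g⁻¹).linearPart (g 0) := by
  have h := mul_apply_zero g⁻¹ g
  rw [inv_mul_cancel] at h
  have h0 : (1 : E ≃ᵃⁱ[ℝ] E) 0 = 0 := rfl
  rw [h0] at h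
  exact (neg_eq_of_add_eq_zero_right h.symm).symm

/-- The commutator estimate for rotations. -/
theorem norm_linearPart_commutator_sub_one_le (g h : E ≃ᵃⁱ[ℝ] E) :
    ‖(g * h * g⁻¹ * h⁻¹).linearPart - 1‖ ≤
      2 * ‖g.linearPart - 1‖ * ‖h.linearPart - 1‖ := by
  -- Factoring out a rotation leaves the additive commutator of `A - 1` and `B - 1`, which is
  -- quadratically small.
  have h1 : (g * h * g⁻¹ * h⁻¹).linearPart - 1 =
      ((g.linearPart - 1) * (h.linearPart - 1) - (h.linearPart - 1) * (g.linearPart - 1)) *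
        ((h * g)⁻¹).linearPart := by
    have h2 : (1 : E →L[ℝ] E) = (h * g).linearPart * ((h * g)⁻¹).linearPart :=
      (linearPart_mul_linearPart_inv _).symm
    rw [show g * h * g⁻¹ * h⁻¹ = g * h * (h * g)⁻¹ by group, linearPart_mul (g * h)]
    nth_rewrite 1 [h2]
    rw [← sub_mul, linearPart_mul, linearPart_mul]
    congr 1
    noncomm_ring
  rw [h1, norm_mul_linearPart]
  refine (norm_sub_le _ _).trans ?_
  have h3 := norm_mul_le (g.linearPart - 1) (h.linearPart - 1)
  have h4 := norm_mul_le (h.linearPart - 1) (g.linearPart - 1)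
  nlinarith

/-- The translational part of a commutator. -/
theorem norm_commutator_apply_zero_sub_le (g h : E ≃ᵃⁱ[ℝ] E) :
    ‖(g * h * g⁻¹ * h⁻¹) 0 - (g.linearPart - 1) (h 0)‖ ≤
      ‖h.linearPart - 1‖ * ‖g 0‖ + 2 * ‖g.linearPart - 1‖ * ‖h.linearPart - 1‖ * ‖h 0‖ := by
  set c := g * h * g⁻¹ * h⁻¹ with hc
  have h1 : c * (h * g) = g * h := by rw [hc]; group
  have h2 := congrArg (fun f : E ≃ᵃⁱ[ℝ] E => f 0) h1
  simp only [mul_apply_zero, map_add] at h2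
  have h3 : c.linearPart * h.linearPart = g.linearPart * h.linearPart * (g⁻¹).linearPart := by
    rw [← linearPart_mul, ← linearPart_mul, ← linearPart_mul, hc]
    congr 1
    group
  have h4 : c 0 - (g.linearPart - 1) (h 0) =
      -(((g.linearPart * (h.linearPart - 1) * (g⁻¹).linearPart) (g 0)) +
        (c.linearPart - 1) (h 0)) := by
    have h5 : (g.linearPart * (h.linearPart - 1) * (g⁻¹).linearPart) (g 0) =
        c.linearPart (h.linearPart (g 0)) - g 0 := by
      rw [mul_sub, mul_one, sub_mul, linearPart_mul_linearPart_inv, ← h3]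
      rfl
    rw [h5]
    simp only [sub_apply, one_apply_eq_self]
    have h6 : c 0 = g.linearPart (h 0) + g 0 - (c.linearPart (h.linearPart (g 0)) +
        c.linearPart (h 0)) := by
      rw [← h2]; abel
    rw [h6]
    abel
  rw [h4, norm_neg]
  refine (norm_add_le _ _).trans (add_le_add ?_ ?_)
  · refine (ContinuousLinearMap.le_opNorm _ _).trans ?_
    rw [norm_mul_linearPart, norm_linearPart_mul]
  · refine (ContinuousLinearMap.le_opNorm _ _).trans ?_
    gcongr
    exact norm_linearPart_commutator_sub_one_le g h

theorem adjoint_linearPart [FiniteDimensional ℝ E] (g : E ≃ᵃⁱ[ℝ] E) :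
    g.linearPart.adjoint = (g⁻¹).linearPart :=
  g.linearIsometryEquiv.adjoint_eq_symm

end AffineIsometryEquiv

end Crystallographic

/-! ### Bieberbach's theorem. -/

section Crystallographic

open Filter Topology AffineIsometryEquiv

variable {E : Type*} [NormedAddCommGroup E] [InnerProductSpace ℝ E] [FiniteDimensional ℝ E]

/-- A group of affine isometries with coarsely dense orbits contains elements with small rotational
part and translational part almost in a given direction. -/
theorem exists_linearPart_near_one_of_dense (Λ : Subgroup (E ≃ᵃⁱ[ℝ] E)) {D : ℝ}
    (hD : ∀ x : E, ∃ g ∈ Λ, ‖g 0 - x‖ ≤ D) (u : E) {ε δ : ℝ} (hε : 0 < ε) (hδ : 0 < δ) :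
    ∃ g ∈ Λ, ‖g.linearPart - 1‖ ≤ ε ∧ ∃ s : ℝ, 0 < s ∧ ‖g 0 - s • u‖ ≤ δ * s := by
  choose g hgΛ hg using fun n : ℕ => hD ((n : ℝ) • u)
  have := FiniteDimensional.proper_real (E →L[ℝ] E)
  obtain ⟨L, -, φ, hφ, hL⟩ := (isCompact_closedBall (0 : E →L[ℝ] E) 1).tendsto_subseq
    (x := fun n => (g n).linearPart) fun n => by simpa using (g n).norm_linearPart_le
  obtain ⟨N, hN⟩ := Metric.cauchySeq_iff'.1 hL.cauchySeq ε hε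
  -- Dividing by a fixed `g (φ N)` cancels the limiting rotation; the bounded translational error is
  -- at most `δ s` once `s` exceeds `M`.
  obtain ⟨M, hM⟩ := exists_nat_gt ((D + ‖g (φ N) 0‖) / δ)
  set j := max (max N M) 1 with hj
  have hjN : N ≤ j := (le_max_left _ _).trans (le_max_left _ _)
  have hjM : M ≤ j := (le_max_right _ _).trans (le_max_left _ _)
  have hj1 : 1 ≤ j := le_max_right _ _
  have hφj : j ≤ φ j := hφ.id_le j
  have hφ0 : (0 : ℝ) < φ j := by exact_mod_cast (by omega : 0 < φ j)
  refine ⟨g (φ j) * (g (φ N))⁻¹, Λ.mul_mem (hgΛ _) (Λ.inv_mem (hgΛ _)), ?_, φ j, hφ0, ?_⟩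
  · have h1 : (g (φ j) * (g (φ N))⁻¹).linearPart - 1 =
        ((g (φ j)).linearPart - (g (φ N)).linearPart) * ((g (φ N))⁻¹).linearPart := by
      rw [linearPart_mul, sub_mul, linearPart_mul_linearPart_inv]
    rw [h1, norm_mul_linearPart, ← dist_eq_norm]
    exact (hN j hjN).le
  · rw [mul_apply_zero, inv_apply_zero]
    have h1 : ‖(g (φ j)).linearPart (-((g (φ N))⁻¹).linearPart (g (φ N) 0))‖ = ‖g (φ N) 0‖ := by
      rw [norm_linearPart_apply, norm_neg, norm_linearPart_apply]
    rw [add_sub_assoc]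
    refine (norm_add_le _ _).trans ?_
    rw [h1]
    have h2 := (div_lt_iff₀ hδ).1 hM
    have h3 : (M : ℝ) ≤ φ j := by exact_mod_cast hjM.trans hφj
    nlinarith [hg (φ j)]

/-- In a discrete group of affine isometries with coarsely dense orbits, elements with small
rotational part are translations. -/
theorem linearPart_eq_one_of_norm_le (Λ : Subgroup (E ≃ᵃⁱ[ℝ] E)) {D : ℝ}
    (hD : ∀ x : E, ∃ g ∈ Λ, ‖g 0 - x‖ ≤ D)
    (hfin : ∀ R : ℝ, {g ∈ (Λ : Set (E ≃ᵃⁱ[ℝ] E)) | ‖g 0‖ ≤ R}.Finite)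
    {g : E ≃ᵃⁱ[ℝ] E} (hg : g ∈ Λ) (hg2 : ‖g.linearPart - 1‖ ≤ 1 / 2) : g.linearPart = 1 := by
  have hmin : ∀ p : (E ≃ᵃⁱ[ℝ] E) → Prop, (∃ h ∈ Λ, p h) →
      ∃ h ∈ Λ, p h ∧ ∀ h' ∈ Λ, p h' → ‖h 0‖ ≤ ‖h' 0‖ := by
    rintro p ⟨h, hh, hp⟩
    obtain ⟨h₁, ⟨⟨hΛ₁, hle₁⟩, hp₁⟩, hmin⟩ := Set.exists_min_image
      {f | (f ∈ Λ ∧ ‖f 0‖ ≤ ‖h 0‖) ∧ p f} (fun f => ‖f 0‖)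
      ((hfin ‖h 0‖).subset fun f hf => hf.1) ⟨h, ⟨hh, le_rfl⟩, hp⟩
    refine ⟨h₁, hΛ₁, hp₁, fun h' hh' hp' => ?_⟩
    rcases le_total ‖h' 0‖ ‖h 0‖ with hle | hle
    · exact hmin h' ⟨⟨hh', hle⟩, hp'⟩
    · exact hle₁.trans hle
  by_contra hne
  -- Take `α` with least translation among nontrivial small rotations, then `β` with least
  -- translation among elements of tiny rotation leaning towards the top eigenspace. Their
  -- commutator again qualifies for the choice of `β`, yet translates less.
  obtain ⟨α, hα, ⟨hα1, hα2⟩, hαmin⟩ := hmin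
    (fun f => f.linearPart ≠ 1 ∧ ‖f.linearPart - 1‖ ≤ 1 / 2) ⟨g, hg, hne, hg2⟩
  set N := α.linearPart - 1 with hN
  have hN0 : N ≠ 0 := sub_ne_zero.2 hα1
  have hnormal : N.adjoint * N = N * N.adjoint := by
    have h1 : N.adjoint = (α⁻¹).linearPart - 1 := by
      rw [hN, map_sub, adjoint_linearPart]
      congr 1
      exact ContinuousLinearMap.adjoint_id
    rw [h1, hN]
    simp only [sub_mul, mul_sub, mul_one, one_mul, linearPart_inv_mul_linearPart,
      linearPart_mul_linearPart_inv]
    abel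
  obtain ⟨P, Q, m', hm'0, hm', hPQ, hPle, hQle, hPN, hQN, hNP, hNQ, u, hu, hPu, hQu⟩ :=
    exists_splitting_of_normal N hN0 hnormal
  set m := ‖N‖ with hm
  have hε : 0 < (m - m') / 8 := by linarith
  obtain ⟨β, hβ, ⟨hβPQ, hβε⟩, hβmin⟩ := hmin
    (fun f => ‖Q (f 0)‖ < ‖P (f 0)‖ ∧ ‖f.linearPart - 1‖ ≤ (m - m') / 8) (by
      obtain ⟨f, hf, hfε, s, hs, hfs⟩ := exists_linearPart_near_one_of_dense Λ hD u hε
        (show (0 : ℝ) < 1 / 4 by norm_num)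
      refine ⟨f, hf, ?_, hfε⟩
      have h1 := (hQle _).trans hfs
      have h2 := (hPle _).trans hfs
      rw [map_sub, map_smul, hQu, smul_zero, sub_zero] at h1
      rw [map_sub, map_smul, hPu] at h2
      have h3 : ‖s • u‖ = s := by rw [norm_smul, hu, mul_one, Real.norm_eq_abs, abs_of_pos hs]
      have h4 := norm_sub_norm_le (s • u) (P (f 0))
      rw [norm_sub_rev, h3] at h4
      linarith)
  set b := β 0 with hb
  set γ := α * β * α⁻¹ * β⁻¹ with hγ
  have hγΛ : γ ∈ Λ := Λ.mul_mem (Λ.mul_mem (Λ.mul_mem hα hβ) (Λ.inv_mem hα)) (Λ.inv_mem hβ)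
  set r := γ 0 - N b with hr
  have hb2 : ‖b‖ < 2 * ‖P b‖ := by
    have := norm_add_le (P b) (Q b)
    rw [hPQ] at this
    linarith
  have hPb : 0 < ‖P b‖ := (norm_nonneg _).trans_lt hβPQ
  have hrle : ‖r‖ ≤ (m - m') / 4 * ‖b‖ := by
    have h1 := norm_commutator_apply_zero_sub_le α β
    -- If `β` rotates at all, it competed in the choice of `α`.
    have h2 : ‖β.linearPart - 1‖ * ‖α 0‖ ≤ ‖β.linearPart - 1‖ * ‖b‖ := by
      by_cases h : β.linearPart = 1
      · rw [h, sub_self, norm_zero, zero_mul, zero_mul]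
      · exact mul_le_mul_of_nonneg_left (hαmin β hβ ⟨h, by linarith⟩) (norm_nonneg _)
    have h3 : 2 * m * ‖β.linearPart - 1‖ * ‖b‖ ≤ ‖β.linearPart - 1‖ * ‖b‖ := by
      rw [mul_assoc]
      exact mul_le_of_le_one_left (by positivity) (by linarith)
    have h4 : ‖β.linearPart - 1‖ * ‖b‖ ≤ (m - m') / 8 * ‖b‖ := by gcongr
    calc ‖r‖ ≤ _ := h1
      _ ≤ _ := add_le_add h2 h3
      _ ≤ _ := by linarith
  have hrlt : ‖r‖ < (m - m') / 2 * ‖P b‖ := by nlinarith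
  have hγ0 : γ 0 = N b + r := by rw [hr]; abel
  have hQγ : ‖Q (γ 0)‖ < (m + m') / 2 * ‖P b‖ := by
    rw [hγ0, map_add, hQN]
    have h1 := norm_add_le (N (Q b)) (Q r)
    have h2 := hNQ b
    have h3 := hQle r
    nlinarith [mul_le_mul_of_nonneg_left hβPQ.le hm'0]
  have hPγ : (m + m') / 2 * ‖P b‖ < ‖P (γ 0)‖ := by
    rw [hγ0, map_add, hPN]
    have h1 := norm_sub_le_norm_add (N (P b)) (P r)
    have h2 := hNP b
    have h3 := hPle r
    nlinarith
  have hγε : ‖γ.linearPart - 1‖ ≤ (m - m') / 8 := by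
    refine (norm_linearPart_commutator_sub_one_le α β).trans (le_trans ?_ hβε)
    exact mul_le_of_le_one_left (norm_nonneg _) (by linarith)
  have hle := hβmin γ hγΛ ⟨hQγ.trans hPγ, hγε⟩
  have h1 : ‖γ 0‖ ≤ m * ‖b‖ + ‖r‖ := by
    rw [hγ0]
    exact (norm_add_le _ _).trans (add_le_add (N.le_opNorm b) le_rfl)
  have hbpos : 0 < ‖b‖ := hPb.trans_le (hPle b)
  -- Since `m ≤ 1/2`, the factor `m + (m - m')/4` is less than `1`, against the minimality of `β`.
  nlinarith

/-- **Bieberbach's theorem**: the translations of a discrete group of affine isometries with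
coarsely dense orbits span the space. -/
theorem span_translations_eq_top (Λ : Subgroup (E ≃ᵃⁱ[ℝ] E)) {D : ℝ}
    (hD : ∀ x : E, ∃ g ∈ Λ, ‖g 0 - x‖ ≤ D)
    (hfin : ∀ R : ℝ, {g ∈ (Λ : Set (E ≃ᵃⁱ[ℝ] E)) | ‖g 0‖ ≤ R}.Finite) :
    Submodule.span ℝ {v : E | ∃ g ∈ Λ, ∀ x, g x = x + v} = ⊤ := by
  set V := Submodule.span ℝ {v : E | ∃ g ∈ Λ, ∀ x, g x = x + v} with hV
  by_contra hne
  -- An element moving `0` almost along `u` with small rotation is a translation, hence lies in `V ⟂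
  -- u`, a contradiction.
  obtain ⟨u, huV, hu0⟩ := Submodule.exists_mem_ne_zero_of_ne_bot
    (mt Submodule.orthogonal_eq_bot_iff.1 hne)
  obtain ⟨g, hg, hg2, s, hs, hgs⟩ := exists_linearPart_near_one_of_dense Λ hD u
    (show (0 : ℝ) < 1 / 2 by norm_num) (show 0 < ‖u‖ / 2 by positivity)
  have h1 := linearPart_eq_one_of_norm_le Λ hD hfin hg hg2
  have hgV : g 0 ∈ V := Submodule.subset_span ⟨g, hg, fun x => by
    rw [apply_eq_linearPart_add, h1]; rfl⟩
  have h2 : inner ℝ (g 0) u = 0 := (Submodule.mem_orthogonal _ _).1 huV _ hgV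
  have h3 : ‖g 0 - s • u‖ ^ 2 = ‖g 0‖ ^ 2 + s ^ 2 * ‖u‖ ^ 2 := by
    rw [norm_sub_sq_real, inner_smul_right, h2, norm_smul, mul_pow, Real.norm_eq_abs, sq_abs]
    ring
  have h4 : 0 < ‖u‖ * s := mul_pos (norm_pos_iff.2 hu0) hs
  nlinarith [norm_nonneg (g 0 - s • u), sq_nonneg ‖g 0‖]

end Crystallographic

/-! ### Coarse isometries and dimension. -/

section CoarseDimension

open Filter Topology

/-- A map between Euclidean spaces which distorts distances by a bounded amount does not lower the
dimension. -/
theorem finrank_le_of_abs_dist_sub_dist_le {E F : Type*} [NormedAddCommGroup E]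
    [InnerProductSpace ℝ E] [NormedAddCommGroup F] [InnerProductSpace ℝ F]
    [FiniteDimensional ℝ F] (φ : E → F) {C : ℝ}
    (hφ : ∀ x y, |dist (φ x) (φ y) - dist x y| ≤ C) :
    Module.finrank ℝ E ≤ Module.finrank ℝ F := by
  have := FiniteDimensional.proper_real F
  have hC : 0 ≤ C := (abs_nonneg _).trans (hφ 0 0)
  set ψ : ℕ → E → F := fun n x => (n : ℝ)⁻¹ • (φ ((n : ℝ) • x) - φ 0) with hψ
  have hψd : ∀ n : ℕ, 0 < n → ∀ x y, |dist (ψ n x) (ψ n y) - dist x y| ≤ C * (n : ℝ)⁻¹ := by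
    intro n hn x y
    have hn' : (0 : ℝ) < n := by exact_mod_cast hn
    have h := hφ ((n : ℝ) • x) ((n : ℝ) • y)
    rw [dist_smul₀, Real.norm_natCast] at h
    have h1 : dist (ψ n x) (ψ n y) = (n : ℝ)⁻¹ * dist (φ ((n : ℝ) • x)) (φ ((n : ℝ) • y)) := by
      rw [hψ, dist_smul₀, dist_sub_right, norm_inv, Real.norm_natCast]
    have h2 : dist (ψ n x) (ψ n y) - dist x y =
        (dist (φ ((n : ℝ) • x)) (φ ((n : ℝ) • y)) - n * dist x y) * (n : ℝ)⁻¹ := by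
      rw [h1]; field_simp
    rw [h2, abs_mul, abs_of_pos (inv_pos.2 hn')]
    gcongr
  -- An ultrafilter takes the limit at all points at once; the rescaled maps become an isometry,
  -- which is affine by strict convexity.
  have hlim : ∀ x, ∃ z, Tendsto (fun n => ψ n x) (hyperfilter ℕ) (𝓝 z) := by
    intro x
    obtain ⟨z, -, hz⟩ := (isCompact_closedBall (0 : F) (dist x 0 + C)).ultrafilter_le_nhds
      ((hyperfilter ℕ).map fun n => ψ n x) (by
        rw [Ultrafilter.coe_map, le_principal_iff, mem_map]
        filter_upwards [Nat.hyperfilter_le_atTop (eventually_gt_atTop 0)] with n hn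
        have h1 := (abs_le.1 (hψd n hn x 0)).2
        have h2 : ψ n 0 = 0 := by simp [hψ]
        have h3 : C * (n : ℝ)⁻¹ ≤ C := mul_le_of_le_one_right hC (Nat.cast_inv_le_one n)
        rw [h2] at h1
        rw [Set.mem_preimage, Metric.mem_closedBall]
        linarith)
    exact ⟨z, hz⟩
  choose Ψ hΨ using hlim
  have hiso : Isometry Ψ := Isometry.of_dist_eq fun x y => by
    have h1 : Tendsto (fun n => dist (ψ n x) (ψ n y) - dist x y) (hyperfilter ℕ) (𝓝 0) := by
      have h0 : Tendsto (fun n : ℕ => C * (n : ℝ)⁻¹) (hyperfilter ℕ) (𝓝 (C * 0)) :=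
        (tendsto_inv_atTop_nhds_zero_nat.const_mul C).mono_left Nat.hyperfilter_le_atTop
      rw [mul_zero] at h0
      refine squeeze_zero_norm' ?_ h0
      filter_upwards [Nat.hyperfilter_le_atTop (eventually_gt_atTop 0)] with n hn
      exact hψd n hn x y
    exact sub_eq_zero.1 (tendsto_nhds_unique (((hΨ x).dist (hΨ y)).sub_const _) h1)
  exact LinearMap.finrank_le_finrank_of_injective
    (f := hiso.affineIsometryOfStrictConvexSpace.linearIsometry.toLinearMap)
    hiso.affineIsometryOfStrictConvexSpace.linearIsometry.injective

end CoarseDimension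

/-! ### Free abelian subgroups up to a finite kernel. -/

section AlmostAbelian

/-- Commutation up to a finite kernel becomes commutation for some power. -/
theorem exists_pow_commute {T A : Type*} [Group T] [CommGroup A] (τ : T →* A)
    (hτ : (τ.ker : Set T).Finite) (a b : T) : ∃ n : ℕ, 0 < n ∧ Commute (a ^ n) b := by
  -- The commutators of powers of `a` with `b` lie in the finite kernel, so two of them coincide.
  have hmaps : Set.MapsTo (fun n : ℕ => a ^ n * b * (a ^ n)⁻¹ * b⁻¹) Set.univ (τ.ker : Set T) := by
    intro n _
    simp [MonoidHom.mem_ker, mul_comm]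
  obtain ⟨i, -, j, -, hij, heq⟩ := Set.infinite_univ.exists_lt_map_eq_of_mapsTo hmaps hτ
  refine ⟨j - i, Nat.sub_pos_of_lt hij, ?_⟩
  have h1 : a ^ i * b * (a ^ i)⁻¹ = a ^ j * b * (a ^ j)⁻¹ := mul_right_cancel heq
  obtain ⟨d, rfl⟩ := Nat.exists_eq_add_of_lt hij
  rw [show i + d + 1 - i = d + 1 by omega]
  rw [add_assoc, pow_add, mul_inv_rev] at h1
  have h2 : b = a ^ (d + 1) * b * (a ^ (d + 1))⁻¹ := by
    have h3 := congrArg (fun x => (a ^ i)⁻¹ * x * a ^ i) h1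
    simpa [mul_assoc] using h3
  rw [commute_iff_eq]
  exact (eq_mul_inv_iff_mul_eq.1 h2).symm

/-- A group with a homomorphism of finite kernel to a real vector space contains a free abelian
group of rank the number of independent vectors in the image. -/
theorem exists_injective_of_linearIndependent {T V : Type*} [Group T] [AddCommGroup V]
    [Module ℝ V] (τ : T →* Multiplicative V) (hτ : (τ.ker : Set T).Finite) {k : ℕ}
    (g : Fin k → T) (hg : LinearIndependent ℝ fun i => (τ (g i)).toAdd) :
    ∃ f : Multiplicative (Fin k → ℤ) →* T, Function.Injective f := by
  choose n hn0 hn using fun i j => exists_pow_commute τ hτ (g i) (g j)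
  -- A common exponent making all generators commute.
  set e := ∏ i, ∏ j, n i j with he
  have he0 : 0 < e := Finset.prod_pos fun i _ => Finset.prod_pos fun j _ => hn0 i j
  have hdvd : ∀ i j, n i j ∣ e := fun i j =>
    (Finset.dvd_prod_of_mem _ (Finset.mem_univ j)).trans
      (Finset.dvd_prod_of_mem (fun i => ∏ j, n i j) (Finset.mem_univ i))
  have hcomm : ∀ i j, Commute (g i ^ e) (g j ^ e) := by
    intro i j
    obtain ⟨c, hc⟩ := hdvd i j
    nth_rewrite 1 [hc]
    rw [pow_mul]
    exact ((hn i j).pow_left c).pow_right e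
  have hcomm' : Pairwise fun i j : Fin k => ∀ x y : Multiplicative ℤ,
      Commute (zpowersHom T (g i ^ e) x) (zpowersHom T (g j ^ e) y) := by
    intro i j _ x y
    simp only [zpowersHom_apply]
    exact ((hcomm i j).zpow_left _).zpow_right _
  set f₀ : (Fin k → Multiplicative ℤ) →* T :=
    MonoidHom.noncommPiCoprod (fun i => zpowersHom T (g i ^ e)) hcomm' with hf₀
  have hτf : ∀ w, (τ (f₀ w)).toAdd = ∑ i, ((w i).toAdd * e : ℝ) • (τ (g i)).toAdd := by
    intro w
    have h1 : τ (f₀ w) = ∏ i, τ (zpowersHom T (g i ^ e) (w i)) := by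
      rw [hf₀, MonoidHom.noncommPiCoprod_apply, Finset.map_noncommProd,
        Finset.noncommProd_eq_prod]
    rw [h1, toAdd_prod]
    refine Finset.sum_congr rfl fun i _ => ?_
    rw [zpowersHom_apply, map_zpow, map_pow, toAdd_zpow, toAdd_pow, mul_smul]
    rw [Int.cast_smul_eq_zsmul, Nat.cast_smul_eq_nsmul]
  have hinj : Function.Injective f₀ := by
    rw [injective_iff_map_eq_one]
    intro w hw
    have h1 := hτf w
    rw [hw, map_one, toAdd_one] at h1
    ext i
    have h2 := Fintype.linearIndependent_iff.1 hg _ h1.symm i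
    have h3 : (e : ℝ) ≠ 0 := by exact_mod_cast he0.ne'
    simpa [h3] using h2
  exact ⟨f₀.comp (MulEquiv.funMultiplicative (Fin k) ℤ).toMonoidHom,
    hinj.comp (MulEquiv.funMultiplicative (Fin k) ℤ).injective⟩

end AlmostAbelian

/-! ### Stabilisers of isolated flats. -/

section Flats

open Filter Topology Pointwise AffineIsometryEquiv

variable {X : Type*} [MetricSpace X]

theorem IsFlat.exists_dist_eq {F : Set X} (hF : IsFlat F) {p : X} (hp : p ∈ F) {d : ℝ}
    (hd : 0 ≤ d) : ∃ q ∈ F, dist p q = d := by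
  obtain ⟨k, hk, f, hf, rfl⟩ := hF
  obtain ⟨x, rfl⟩ := hp
  exact ⟨f (x + EuclideanSpace.single ⟨0, by omega⟩ d), ⟨_, rfl⟩, by
    rw [hf.dist_eq, dist_self_add_right, PiLp.norm_single, Real.norm_eq_abs,
      abs_of_nonneg hd]⟩

/-- A family of isolated flats in a proper space is locally finite. -/
theorem finite_flats_inter_closedBall [ProperSpace X] {𝓕 : Set (Set X)}
    (hflat : ∀ F ∈ 𝓕, IsFlat F) {ψ : NNReal → NNReal}
    (hψ : ∀ F₁ ∈ 𝓕, ∀ F₂ ∈ 𝓕, F₁ ≠ F₂ → ∀ r : NNReal,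
      ∀ x ∈ Metric.thickening (r : ℝ) F₁ ∩ Metric.thickening (r : ℝ) F₂,
      ∀ y ∈ Metric.thickening (r : ℝ) F₁ ∩ Metric.thickening (r : ℝ) F₂,
        dist x y ≤ (ψ r : ℝ)) (z : X) (R : ℝ) :
    {F ∈ 𝓕 | (F ∩ Metric.closedBall z R).Nonempty}.Finite := by
  -- Pairs at distance `d` exceed the bound for overlapping `1`-neighbourhoods; compactness would
  -- place such pairs from two distinct flats within `1` of each other.
  set d : ℝ := ψ 1 + 1 with hd
  have hd0 : 0 ≤ d := by positivity
  by_contra hinf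
  have hpq : ∀ F : {F ∈ 𝓕 | (F ∩ Metric.closedBall z R).Nonempty}, ∃ p q : X, p ∈ F.1 ∧ q ∈ F.1 ∧
      dist p z ≤ R ∧ dist p q = d := by
    rintro ⟨F, hF, p, hpF, hpR⟩
    obtain ⟨q, hqF, hq⟩ := (hflat F hF).exists_dist_eq hpF hd0
    exact ⟨p, q, hpF, hqF, hpR, hq⟩
  choose p q hp hq hpR hpqd using hpq
  have hcomp : IsCompact (Metric.closedBall z (R + d) ×ˢ Metric.closedBall z (R + d)) :=
    (isCompact_closedBall _ _).prod (isCompact_closedBall _ _)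
  obtain ⟨t, htfin, ht⟩ := Metric.totallyBounded_iff.1 hcomp.totallyBounded (1 / 2) (by norm_num)
  have hmem : ∀ F, (p F, q F) ∈ ⋃ y ∈ t, Metric.ball y (1 / 2) := by
    intro F
    refine ht ⟨?_, ?_⟩
    · rw [Metric.mem_closedBall]
      linarith [hpR F]
    · rw [Metric.mem_closedBall]
      linarith [hpR F, dist_triangle (q F) (p F) z, dist_comm (p F) (q F), hpqd F]
  simp only [Set.mem_iUnion₂] at hmem
  choose c hct hc using hmem
  have : Infinite {F ∈ 𝓕 | (F ∩ Metric.closedBall z R).Nonempty} := Set.infinite_coe_iff.2 hinf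
  obtain ⟨F₁, -, F₂, -, hne, heq⟩ := Set.infinite_univ.exists_ne_map_eq_of_mapsTo
    (f := c) (fun F _ => hct F) htfin
  have h1 : dist (p F₁, q F₁) (p F₂, q F₂) < 1 := by
    have h1 := hc F₁
    have h2 := hc F₂
    rw [← heq] at h2
    rw [Metric.mem_ball] at h1 h2
    linarith [dist_triangle_right (p F₁, q F₁) (p F₂, q F₂) (c F₁)]
  rw [Prod.dist_eq, max_lt_iff] at h1
  have h2 := hψ F₁ F₁.2.1 F₂ F₂.2.1 (fun h => hne (Subtype.ext h)) 1 (p F₁)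
    ⟨Metric.mem_thickening_iff.2 ⟨_, hp F₁, by simp⟩,
      Metric.mem_thickening_iff.2 ⟨_, hp F₂, by simpa using h1.1⟩⟩ (q F₁)
    ⟨Metric.mem_thickening_iff.2 ⟨_, hq F₁, by simp⟩,
      Metric.mem_thickening_iff.2 ⟨_, hq F₂, by simpa using h1.2⟩⟩
  rw [hpqd] at h2
  linarith

variable {G : Type*} [Group G] [MulAction G X]

/-- In an invariant, locally finite family, stabilisers have coarsely dense orbits. -/
theorem IsGeometricAction.exists_dist_stabilizer_le (hG : IsGeometricAction G X)
    {𝓕 : Set (Set X)} (hinv : ∀ g : G, ∀ F ∈ 𝓕, g • F ∈ 𝓕)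
    (hfin : ∀ z R, {F ∈ 𝓕 | (F ∩ Metric.closedBall z R).Nonempty}.Finite)
    {F : Set X} (hF : F ∈ 𝓕) (p : X) :
    ∃ D : ℝ, ∀ x ∈ F, ∃ g ∈ MulAction.stabilizer G F, dist (g • p) x ≤ D := by
  have := hG.isometric
  obtain ⟨K, hK, hcov⟩ := hG.cocompact
  obtain ⟨R, hR⟩ := hK.isBounded.subset_closedBall p
  -- Only finitely many translates of `F` come near `p`; fix for each an element carrying it back to
  -- `F`, and use it to correct `g` into the stabiliser.
  set 𝓢 := {F' | ∃ g : G, g • F' = F} ∩ {F' ∈ 𝓕 | (F' ∩ Metric.closedBall p R).Nonempty} with h𝓢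
  have h𝓢fin : 𝓢.Finite := (hfin p R).subset Set.inter_subset_right
  choose h hh using fun F' : 𝓢 => F'.2.1
  have := h𝓢fin.to_subtype
  obtain ⟨D, hD⟩ := (Set.finite_range fun F' : 𝓢 => dist p (h F' • p)).bddAbove
  refine ⟨D + R, fun x hx => ?_⟩
  have hx' : x ∈ ⋃ g : G, (fun x : X => g • x) '' K := hcov ▸ Set.mem_univ x
  obtain ⟨g, y, hy, rfl⟩ := Set.mem_iUnion.1 hx'
  have hmem : g⁻¹ • F ∈ 𝓢 := by
    refine ⟨⟨g, smul_inv_smul g F⟩, hinv _ F hF, y, ?_, hR hy⟩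
    rw [Set.mem_inv_smul_set_iff]
    exact hx
  set h₀ := h ⟨_, hmem⟩ with hh₀
  have hh₀F : h₀ • g⁻¹ • F = F := hh ⟨_, hmem⟩
  refine ⟨g * h₀⁻¹, ?_, ?_⟩
  · rw [MulAction.mem_stabilizer_iff, mul_smul]
    nth_rewrite 1 [← hh₀F]
    rw [inv_smul_smul, smul_inv_smul]
  · simp only [mul_smul, dist_smul]
    have h1 : dist p (h₀ • p) ≤ D := hD ⟨⟨_, hmem⟩, rfl⟩
    have h2 : dist y p ≤ R := hR hy
    have h3 : dist (h₀⁻¹ • p) p = dist p (h₀ • p) := by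
      rw [← dist_smul h₀, smul_inv_smul]
    rw [← h3] at h1
    linarith [dist_triangle_right (h₀⁻¹ • p) y p]

/-- The stabiliser of a flat acts on it by affine isometries. -/
theorem exists_stabilizer_hom [IsIsometricSMul G X] {E : Type*} [NormedAddCommGroup E]
    [NormedSpace ℝ E] {f : E → X} (hf : Isometry f) :
    ∃ ρ : MulAction.stabilizer G (Set.range f) →* (E ≃ᵃⁱ[ℝ] E),
      ∀ g x, f (ρ g x) = (g : G) • f x := by
  have hex : ∀ (g : MulAction.stabilizer G (Set.range f)) (x : E), ∃ y, f y = (g : G) • f x := by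
    intro g x
    have h1 : (g : G) • f x ∈ (g : G) • Set.range f := Set.smul_mem_smul_set ⟨x, rfl⟩
    rwa [MulAction.mem_stabilizer_iff.1 g.2] at h1
  choose r hr using hex
  have hri : ∀ g, Isometry (r g) := fun g => Isometry.of_dist_eq fun x y => by
    rw [← hf.dist_eq, hr, hr, dist_smul, hf.dist_eq]
  have hrinv : ∀ g x, r g (r g⁻¹ x) = x := fun g x => hf.injective (by
    rw [hr, hr, InvMemClass.coe_inv, smul_inv_smul])
  set φ : MulAction.stabilizer G (Set.range f) → (E ≃ᵃⁱ[ℝ] E) := fun g =>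
    (IsometryEquiv.mk' (r g) (r g⁻¹) (hrinv g) (hri g)).toRealAffineIsometryEquiv with hφ
  have hφr : ∀ g x, φ g x = r g x := fun g x => by
    simp only [hφ]
    rfl
  refine ⟨MonoidHom.mk' φ fun g h => ?_, fun g x => ?_⟩
  · ext x
    refine hf.injective ?_
    rw [AffineIsometryEquiv.coe_mul, Function.comp_apply]
    rw [hφr, hφr, hφr, hr, hr, hr, Subgroup.coe_mul, mul_smul]
  · rw [MonoidHom.mk'_apply, hφr, hr]

/-- A group acting on a Euclidean space properly and with coarsely dense orbits contains a free
abelian group of full rank. -/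
theorem exists_injective_of_affine_action {E S : Type*} [NormedAddCommGroup E]
    [InnerProductSpace ℝ E] [FiniteDimensional ℝ E] [Group S] (ρ : S →* (E ≃ᵃⁱ[ℝ] E))
    (hfin : ∀ R : ℝ, {g | ‖ρ g 0‖ ≤ R}.Finite) {D : ℝ} (hD : ∀ x, ∃ g, ‖ρ g 0 - x‖ ≤ D)
    {k : ℕ} (hk : k ≤ Module.finrank ℝ E) :
    ∃ f : Multiplicative (Fin k → ℤ) →* S, Function.Injective f := by
  have hspan := span_translations_eq_top ρ.range (D := D)
    (fun x => (hD x).elim fun g hg => ⟨ρ g, ⟨g, rfl⟩, hg⟩)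
    (fun R => ((hfin R).image ρ).subset (by
      rintro _ ⟨⟨g, rfl⟩, hg⟩
      exact ⟨g, hg, rfl⟩))
  set s := {v : E | ∃ g ∈ ρ.range, ∀ x, g x = x + v} with hs
  obtain ⟨v, hvs, -, hv⟩ := Submodule.exists_fun_fin_finrank_span_eq ℝ s
  have hk' : k ≤ Module.finrank ℝ (Submodule.span ℝ s) := by rwa [hspan, finrank_top]
  choose g' hg' hgv using hvs
  choose g hg using hg'
  have hmulzero : ∀ a b, ρ (a * b) 0 = (ρ a).linearPart (ρ b 0) + ρ a 0 := fun a b => by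
    rw [map_mul, mul_apply_zero]
  -- `T` consists of the elements acting as translations; `ρ` need not be faithful, but by
  -- properness its kernel is finite.
  set T : Subgroup S :=
    { carrier := {a | (ρ a).linearPart = 1}
      mul_mem' := fun {a b} ha hb => by
        simp only [Set.mem_ofPred_eq] at ha hb ⊢
        rw [map_mul, linearPart_mul, ha, hb, one_mul]
      one_mem' := by
        simp only [Set.mem_ofPred_eq]
        rw [map_one, linearPart_one]
      inv_mem' := fun {a} ha => by
        simp only [Set.mem_ofPred_eq] at ha ⊢
        have h := linearPart_mul_linearPart_inv (ρ a)
        rwa [ha, one_mul, ← map_inv] at h }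
  have hT : ∀ a, a ∈ T ↔ (ρ a).linearPart = 1 := fun a => Iff.rfl
  let τ : T →* Multiplicative E := MonoidHom.mk' (fun a => .ofAdd (ρ a 0)) fun a b => by
    rw [← ofAdd_add, Subgroup.coe_mul, hmulzero, (hT _).1 a.2, one_apply_eq_self, add_comm]
  have hτ : ∀ a : T, (τ a).toAdd = ρ a 0 := fun a => rfl
  have hker : (τ.ker : Set T).Finite := by
    refine ((hfin 0).preimage (f := ((↑) : T → S)) Subtype.val_injective.injOn).subset fun a ha => ?_
    have h1 : ρ a 0 = 0 := by
      rw [← hτ, MonoidHom.mem_ker.1 ha, toAdd_one]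
    simp [h1]
  have hgT : ∀ i, g i ∈ T := fun i => by
    rw [hT]
    ext x
    have h1 := apply_eq_linearPart_add (ρ (g i)) x
    rw [hg, hgv, hgv, zero_add, add_left_inj] at h1
    rw [hg, ← h1, one_apply_eq_self]
  obtain ⟨f, hf⟩ := exists_injective_of_linearIndependent τ hker
    (fun i : Fin k => ⟨g (Fin.castLE hk' i), hgT _⟩) (by
      have h1 := hv.comp (Fin.castLE hk') (Fin.castLE_injective hk')
      convert! h1 using 2 with i
      rw [hτ, hg, hgv, zero_add]
      rfl)
  exact ⟨T.subtype.comp f, T.subtype_injective.comp hf⟩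

/-- The stabiliser of `F` itself may be too small, so the argument passes to a nearby `F'` of the
family, of dimension at least `k`, where the stabiliser has coarsely dense orbits. -/
theorem IsGeometricAction.exists_injective_of_isKFlat (hX : IsCAT0 X)
    (hflats : HasIsolatedFlats X) (hG : IsGeometricAction G X) {k : ℕ} {F : Set X}
    (hF : IsKFlat k F) : ∃ f : Multiplicative (Fin k → ℤ) →* G, Function.Injective f := by
  have := hG.isometric
  have := hG.properSpace hX
  obtain ⟨𝓕, hflat, ⟨B, hB⟩, ⟨ψ, hψ⟩, hinv⟩ := hflats
  obtain ⟨F', hF', hFF'⟩ := hB F ⟨k, hF⟩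
  obtain ⟨-, e, he, rfl⟩ := hF
  obtain ⟨m, -, f, hf, rfl⟩ := hflat F' hF'
  have hkm : k ≤ m := by
    have h1 : ∀ x, ∃ y, dist (e x) (f y) < B := fun x => by
      obtain ⟨_, ⟨y, rfl⟩, hy⟩ := Metric.mem_thickening_iff.1 (hFF' ⟨x, rfl⟩)
      exact ⟨y, hy⟩
    choose φ hφ using h1
    have h2 := finrank_le_of_abs_dist_sub_dist_le φ (C := 2 * B) fun x y => by
      rw [← hf.dist_eq, ← he.dist_eq x y, abs_le]
      have h3 := dist_triangle4 (e x) (f (φ x)) (f (φ y)) (e y)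
      have h4 := dist_triangle4 (f (φ x)) (e x) (e y) (f (φ y))
      rw [dist_comm (f (φ y))] at h3
      rw [dist_comm (f (φ x)) (e x)] at h4
      constructor <;> linarith [hφ x, hφ y]
    simpa using h2
  obtain ⟨D, hD⟩ := hG.exists_dist_stabilizer_le
    (fun g F hF => hinv (IsometryEquiv.constSMul g) F hF)
    (finite_flats_inter_closedBall hflat hψ) hF' (f 0)
  obtain ⟨ρ, hρ⟩ := exists_stabilizer_hom (G := G) hf
  obtain ⟨h, hh⟩ := exists_injective_of_affine_action ρ (D := D) (k := k) (fun R => by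
      refine ((hG.finite_dist_smul_le (f 0) R).preimage (f := Subtype.val)
        Subtype.val_injective.injOn).subset fun g hg => ?_
      rw [Set.mem_ofPred_eq, ← dist_zero_left, ← hf.dist_eq, hρ] at hg
      exact hg) (fun x => by
      obtain ⟨g, hg, hgx⟩ := hD (f x) ⟨x, rfl⟩
      exact ⟨⟨g, hg⟩, by rwa [← dist_eq_norm, ← hf.dist_eq, hρ]⟩) (by simpa using hkm)
  exact ⟨(Subgroup.subtype _).comp h, (Subgroup.subtype_injective _).comp hh⟩

end Flats

theorem corollary3p7 {G X : Type*} [Group G] [MetricSpace X] [Nonempty X] [MulAction G X]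
    (hX : IsCAT0 X) (hflats : HasIsolatedFlats X) (hG : IsGeometricAction G X)
    (k : ℕ) (hk : 2 ≤ k) :
    (∃ F : Set X, IsKFlat k F) ↔
      ∃ H : Subgroup G, Nonempty (H ≃* Multiplicative (Fin k → ℤ)) := by
  constructor
  · rintro ⟨F, hF⟩
    obtain ⟨f, hf⟩ := hG.exists_injective_of_isKFlat hX hflats hF
    exact ⟨f.range, ⟨(MonoidHom.ofInjective hf).symm⟩⟩
  · rintro ⟨H, ⟨e⟩⟩
    obtain ⟨Φ, hΦ⟩ := hG.exists_isometry_of_injective hX (H.subtype.comp e.symm.toMonoidHom)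
      (H.subtype_injective.comp e.symm.injective)
    exact ⟨Set.range Φ, hk, Φ, hΦ, rfl⟩
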